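/- Let $y = X\beta + \varepsilon \in \mathbb{R}^n$, where $X=(x_1,\dots,x_p)$ is a fixed $n\times p$ design matrix with $\sum_i x_{ij}=0$ and $\frac1n\|x_j\|_2^2=1$ for every $j$, $\beta\in\mathbb{R}^p$, and $\varepsilon\sim N(0,\sigma^2 I_n)$ with $\sigma>0$. Put $S_1=\{j:\beta_j\ne 0\}$, $S_0=\{j:\beta_j=0\}$. For a fixed $\lambda>0$ let $\tilde\beta=\arg\min_b \|y-Xb\|_2^2+\lambda\|b\|_1$, where the minimizer is assumed to be almost surely unique, and let $\hat S=\{j:\tilde\beta_j\neq 0\}$ and $\hat s=\mathrm{sign}(\tilde\beta_{\hat S})$. For each $j$ let $z_j\sim N(0,I_n)$ be independent of $\varepsilon$. *Post-selection Gaussian mirror.* Given $(\hat S,\hat s)=(S,s)$ and $j\in S$, let $P_S$ be the orthogonal projection onto the span of the columns of $X_S$, $\tilde z_j=(I-P_S)z_j$, let $P_{S\setminus j}$ be the projection onto the span of the columns of $X_{S\setminus\{j\}}$, and $$c_j=\sqrt{\frac{x_j^\top(I-P_{S\setminus j})x_j}{\tilde z_j^\top(I-P_{S\setminus j})\tilde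 z_j}} .$$ The mirror design is $W=(x_j+c_j\tilde z_j,\;x_j-c_j\tilde z_j,\;X_{S\setminus\{j\}})$; $\psi_1^\top,\psi_2^\top$ are the first two rows of $(W^\top W)^{-1}W^\top$, and $\hat\beta_j^+=\psi_1^\top y$, $\hat\beta_j^-=\psi_2^\top y$ are the first two coefficients of the least squares regression of $y$ on $W$. Let $\alpha=\psi_1^\top\psi_1$ $(=\psi_2^\top\psi_2)$, let $\tau_j=\sigma\sqrt{2\alpha}=\sigma\|\psi_1\pm\psi_2\|_2$ be the conditional standard deviation of $\hat\beta_j^+\pm\hat\beta_j^-$ given $z_j$ for fixed $S$ (before conditioning on the selection), and let $r$ be $y$ minus its projection onto $\mathrm{span}(\psi_1,\psi_2)$. Put $$A_0=\tfrac{2}{\lambda}\begin{pmatrix}X_{-S}^\top(I-P_S)\\-X_{-S}^\top(I-P_S)\end{pmatrix},\quad b_0=\begin{pmatrix}1-X_{-S}^\top X_S(X_S^\top X_S)^{-1}s\\1+X_{-S}^\top X_S(X_S^\top X_S)^{-1}s\end{pmatrix},$$ $$A_1=-\mathrm{diag}(s)(X_S^\top X_S)^{-1}X_S^\top,\quad b_1=-\tfrac{\lambda}{2}\,\mathrm{diag}(s)(X_S^\top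 X_S)^{-1}s,$$ $a_0=A_0(\psi_1-\psi_2)/2$, $a_1=A_1(\psi_1+\psi_2)/2$, and for $\ell=0,1$ $$V_\ell^-=\max_{i:\,a_{\ell i}<0}\frac{\alpha\,(b_{\ell i}-(A_\ell r)_i)}{a_{\ell i}},\qquad V_\ell^+=\min_{i:\,a_{\ell i}>0}\frac{\alpha\,(b_{\ell i}-(A_\ell r)_i)}{a_{\ell i}}$$ ($-\infty$, respectively $+\infty$, if there is no such $i$). With $F^{[a,b]}_{0,\tau^2}$ the distribution function of $N(0,\tau^2)$ truncated to $[a,b]$ and $\Phi$ the standard normal distribution function, the mirror statistic is $$M_j=\Big|\tau_j\Phi^{-1}F^{[V_1^-,V_1^+]}_{0,\tau_j^2}(\hat\beta_j^++\hat\beta_j^-)\Big|-\Big|\tau_j\Phi^{-1}F^{[V_0^-,V_0^+]}_{0,\tau_j^2}(\hat\beta_j^+-\hat\beta_j^-)\Big| ,$$ evaluated at $(S,s)=(\hat S,\hat s)$ if $j\in\hat S$, and $M_j=0$ if $j\notin\hat S$. **Theorem.** Every $M_j$ is a random variable, and for every $j\in S_0$: (i) for all $S\ni j$ with $S\supseteq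 S_1$ and all $s$, conditionally on $\{\hat S=S,\hat s=s\}$, one has $P(M_j\le -t\mid z_j)=P(M_j\ge t\mid z_j)$ almost surely, for all $t>0$; (ii) the same identity holds conditionally on the event $\{S_1\subseteq\hat S\}$. (iii) Moreover $P(S_1\subseteq \hat S)\ge 1-2/p$ if $\lambda=2n\lambda_n$ with $\lambda_n=4\sigma\sqrt{\log(p)/n}$ (that is, if $\tilde\beta$ minimizes $\frac1{2n}\|y-Xb\|_2^2+\lambda_n\|b\|_1$) and, for some $\phi_0>0$, the following two conditions hold: every $a\in\mathbb{R}^p$ with $\|a_{S_0}\|_1\le 3\|a_{S_1}\|_1$ satisfies $\|a_{S_1}\|_1^2\le\frac{|S_1|}{\phi_0^2}\cdot\frac1n a^\top X^\top Xa$ (compatibility); and $|\beta_j|>\frac{64\sigma|S_1|}{\phi_0^2}\sqrt{\log(p)/n}$ for all $j\in S_1$ (signal strength). -/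

import Mathlib

open MeasureTheory ProbabilityTheory Matrix

namespace GaussianMirror

noncomputable section

/-! Linear algebra of the design matrix. -/

/-- The submatrix `X_S` formed by the columns with index in `S`. -/
def colSub {n p : ℕ} (X : Matrix (Fin n) (Fin p) ℝ) (S : Finset (Fin p)) :
    Matrix (Fin n) {k // k ∈ S} ℝ :=
  X.submatrix id Subtype.val

/-- The submatrix `X_{-S}` formed by the columns with index outside `S`. -/
def colCompl {n p : ℕ} (X : Matrix (Fin n) (Fin p) ℝ) (S : Finset (Fin p)) :
    Matrix (Fin n) {k // k ∉ S} ℝ :=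
  X.submatrix id Subtype.val

/-- The matrix `W (Wᵀ W)⁻¹ Wᵀ` of the orthogonal projection onto the column space of `W`
(for `W` of full column rank). -/
def projMat {n : ℕ} {ι : Type*} [Fintype ι] [DecidableEq ι] (W : Matrix (Fin n) ι ℝ) :
    Matrix (Fin n) (Fin n) ℝ :=
  W * (Wᵀ * W)⁻¹ * Wᵀ

/-! The lasso. -/

/-- The lasso objective `‖y - X b‖₂² + lam ‖b‖₁`. -/
def lassoObjective {n p : ℕ} (X : Matrix (Fin n) (Fin p) ℝ) (lam : ℝ) (y : Fin n → ℝ)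
    (b : Fin p → ℝ) : ℝ :=
  (y - X *ᵥ b) ⬝ᵥ (y - X *ᵥ b) + lam * ∑ k, |b k|

/-- `b` minimizes the lasso objective. -/
def IsLassoSolution {n p : ℕ} (X : Matrix (Fin n) (Fin p) ℝ) (lam : ℝ) (y : Fin n → ℝ)
    (b : Fin p → ℝ) : Prop :=
  ∀ b', lassoObjective X lam y b ≤ lassoObjective X lam y b'

/-- The lasso estimator: the minimizer of the lasso objective. -/
def lasso {n p : ℕ} (X : Matrix (Fin n) (Fin p) ℝ) (lam : ℝ) (y : Fin n → ℝ) : Fin p → ℝ :=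
  Classical.epsilon (IsLassoSolution X lam y)

/-- The set of indices of the nonzero entries of a coefficient vector. -/
def activeSet {p : ℕ} (b : Fin p → ℝ) : Finset (Fin p) :=
  Finset.univ.filter fun k => b k ≠ 0

/-- The set selected by the lasso. -/
def lassoSet {n p : ℕ} (X : Matrix (Fin n) (Fin p) ℝ) (lam : ℝ) (y : Fin n → ℝ) :
    Finset (Fin p) :=
  activeSet (lasso X lam y)

/-- The signs of the lasso coefficients on an index set. -/
def lassoSign {n p : ℕ} (X : Matrix (Fin n) (Fin p) ℝ) (lam : ℝ) (y : Fin n → ℝ)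
    (S : Finset (Fin p)) : {k // k ∈ S} → ℝ :=
  fun k => Real.sign (lasso X lam y k.1)

/-! The polyhedral description `A₀ y ≤ b₀`, `A₁ y ≤ b₁` of the event that the lasso selects the
set `S` with sign vector `s`. As the squared loss of the objective carries no factor `1/2`, the
penalty level enters as `lam / 2`. -/

/-- Matrix of the inactive constraints. -/
def inactiveMat {n p : ℕ} (X : Matrix (Fin n) (Fin p) ℝ) (lam : ℝ) (S : Finset (Fin p)) :
    Matrix ({k // k ∉ S} ⊕ {k // k ∉ S}) (Fin n) ℝ :=
  (lam / 2)⁻¹ • Matrix.fromRows ((colCompl X S)ᵀ * (1 - projMat (colSub X S)))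
    (-((colCompl X S)ᵀ * (1 - projMat (colSub X S))))

/-- The vector `X_{-S}ᵀ (X_Sᵀ)⁺ s`, with the pseudoinverse `(X_Sᵀ)⁺ = X_S (X_Sᵀ X_S)⁻¹`. -/
def inactiveShift {n p : ℕ} (X : Matrix (Fin n) (Fin p) ℝ) (S : Finset (Fin p))
    (s : {k // k ∈ S} → ℝ) : {k // k ∉ S} → ℝ :=
  ((colCompl X S)ᵀ * (colSub X S * ((colSub X S)ᵀ * colSub X S)⁻¹)) *ᵥ s

/-- Right-hand side of the inactive constraints. -/
def inactiveBound {n p : ℕ} (X : Matrix (Fin n) (Fin p) ℝ) (S : Finset (Fin p))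
    (s : {k // k ∈ S} → ℝ) : {k // k ∉ S} ⊕ {k // k ∉ S} → ℝ :=
  Sum.elim (fun k => 1 - inactiveShift X S s k) (fun k => 1 + inactiveShift X S s k)

/-- Matrix of the active constraints. -/
def activeMat {n p : ℕ} (X : Matrix (Fin n) (Fin p) ℝ) (S : Finset (Fin p))
    (s : {k // k ∈ S} → ℝ) : Matrix {k // k ∈ S} (Fin n) ℝ :=
  -(Matrix.diagonal s * ((colSub X S)ᵀ * colSub X S)⁻¹ * (colSub X S)ᵀ)

/-- Right-hand side of the active constraints. -/
def activeBound {n p : ℕ} (X : Matrix (Fin n) (Fin p) ℝ) (lam : ℝ) (S : Finset (Fin p))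
    (s : {k // k ∈ S} → ℝ) : {k // k ∈ S} → ℝ :=
  -(lam / 2) • ((Matrix.diagonal s * ((colSub X S)ᵀ * colSub X S)⁻¹) *ᵥ s)

/-! The post-selection Gaussian mirror for the variable `j` in the selected set `S`. -/

/-- The projection `z̃ = (I - P_S) z` of the simulated vector. -/
def zTilde {n p : ℕ} (X : Matrix (Fin n) (Fin p) ℝ) (S : Finset (Fin p)) (z : Fin n → ℝ) :
    Fin n → ℝ :=
  (1 - projMat (colSub X S)) *ᵥ z

/-- The scale `c_j` of the mirror. -/
def mirrorScale {n p : ℕ} (X : Matrix (Fin n) (Fin p) ℝ) (S : Finset (Fin p)) (j : Fin p)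
    (z : Fin n → ℝ) : ℝ :=
  Real.sqrt
    ((X.col j ⬝ᵥ ((1 - projMat (colSub X (S.erase j))) *ᵥ X.col j)) /
      (zTilde X S z ⬝ᵥ ((1 - projMat (colSub X (S.erase j))) *ᵥ zTilde X S z)))

/-- The mirror design: the columns `x_j + c_j z̃`, `x_j - c_j z̃` (indices `inl 0`, `inl 1`) and
`x_k` for `k ∈ S`, `k ≠ j`. -/
def mirrorDesign {n p : ℕ} (X : Matrix (Fin n) (Fin p) ℝ) (S : Finset (Fin p)) (j : Fin p)
    (z : Fin n → ℝ) : Matrix (Fin n) (Fin 2 ⊕ {k // k ∈ S.erase j}) ℝ :=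
  Matrix.of fun i => Sum.elim
    ![X i j + mirrorScale X S j z * zTilde X S z i, X i j - mirrorScale X S j z * zTilde X S z i]
    (fun k => X i k.1)

/-- The vectors `ψ₁` (for `l = 0`) and `ψ₂` (for `l = 1`): the first two rows of `(WᵀW)⁻¹Wᵀ`,
where `W` is the mirror design. -/
def mirrorPsi {n p : ℕ} (X : Matrix (Fin n) (Fin p) ℝ) (S : Finset (Fin p)) (j : Fin p)
    (z : Fin n → ℝ) (l : Fin 2) : Fin n → ℝ :=
  (((mirrorDesign X S j z)ᵀ * mirrorDesign X S j z)⁻¹ * (mirrorDesign X S j z)ᵀ) (Sum.inl l)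

/-- The least squares coefficient of `x_j + c_j z̃`. -/
def betaPlus {n p : ℕ} (X : Matrix (Fin n) (Fin p) ℝ) (S : Finset (Fin p)) (j : Fin p)
    (z y : Fin n → ℝ) : ℝ :=
  mirrorPsi X S j z 0 ⬝ᵥ y

/-- The least squares coefficient of `x_j - c_j z̃`. -/
def betaMinus {n p : ℕ} (X : Matrix (Fin n) (Fin p) ℝ) (S : Finset (Fin p)) (j : Fin p)
    (z y : Fin n → ℝ) : ℝ :=
  mirrorPsi X S j z 1 ⬝ᵥ y

/-- `α = ψ₁ᵀψ₁` (which equals `ψ₂ᵀψ₂`). -/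
def mirrorAlpha {n p : ℕ} (X : Matrix (Fin n) (Fin p) ℝ) (S : Finset (Fin p)) (j : Fin p)
    (z : Fin n → ℝ) : ℝ :=
  mirrorPsi X S j z 0 ⬝ᵥ mirrorPsi X S j z 0

/-- `r = (I - P_ψ) y`, the residual of `y` after projection onto the span of `ψ₁` and `ψ₂`. -/
def mirrorResidual {n p : ℕ} (X : Matrix (Fin n) (Fin p) ℝ) (S : Finset (Fin p)) (j : Fin p)
    (z y : Fin n → ℝ) : Fin n → ℝ :=
  (1 - projMat (Matrix.of fun i l => mirrorPsi X S j z l i)) *ᵥ y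

/-- The vector `a₀` with `A₀ (ψ₁, ψ₂) = a₀ (1, -1)`. -/
def inactiveDir {n p : ℕ} (X : Matrix (Fin n) (Fin p) ℝ) (lam : ℝ) (S : Finset (Fin p))
    (j : Fin p) (z : Fin n → ℝ) : {k // k ∉ S} ⊕ {k // k ∉ S} → ℝ :=
  inactiveMat X lam S *ᵥ ((1 / 2 : ℝ) • (mirrorPsi X S j z 0 - mirrorPsi X S j z 1))

/-- The vector `a₁` with `A₁ (ψ₁, ψ₂) = a₁ (1, 1)`. -/
def activeDir {n p : ℕ} (X : Matrix (Fin n) (Fin p) ℝ) (S : Finset (Fin p))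
    (s : {k // k ∈ S} → ℝ) (j : Fin p) (z : Fin n → ℝ) : {k // k ∈ S} → ℝ :=
  activeMat X S s *ᵥ ((1 / 2 : ℝ) • (mirrorPsi X S j z 0 + mirrorPsi X S j z 1))

/-! Truncation points. A system `(a / α) u + A r ≤ b` of linear constraints on a number `u`
forces `u` to lie between the following bounds. -/

/-- The largest of the lower bounds, `-∞` if there are none. -/
def truncLower {n : ℕ} {ι : Type*} (a b : ι → ℝ) (A : Matrix ι (Fin n) ℝ) (α : ℝ)
    (r : Fin n → ℝ) : EReal :=
  ⨆ i, ⨆ _ : a i < 0, ((α * (b i - (A *ᵥ r) i) / a i : ℝ) : EReal)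

/-- The smallest of the upper bounds, `+∞` if there are none. -/
def truncUpper {n : ℕ} {ι : Type*} (a b : ι → ℝ) (A : Matrix ι (Fin n) ℝ) (α : ℝ)
    (r : Fin n → ℝ) : EReal :=
  ⨅ i, ⨅ _ : 0 < a i, ((α * (b i - (A *ᵥ r) i) / a i : ℝ) : EReal)

/-! The truncated normal distribution. -/

/-- The distribution function of `N(m, τ²)`, at an extended real number. -/
def normalCdf (m τ : ℝ) (x : EReal) : ℝ :=
  (gaussianReal m (τ ^ 2).toNNReal).real {u : ℝ | (u : EReal) ≤ x}

/-- The distribution function of `N(m, τ²)` truncated to the interval `[a, b]`. -/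
def truncNormalCdf (m τ : ℝ) (a b : EReal) (x : ℝ) : ℝ :=
  (normalCdf m τ x - normalCdf m τ a) / (normalCdf m τ b - normalCdf m τ a)

/-- The inverse `Φ⁻¹` of the standard normal distribution function (on `(0, 1)`). -/
def stdNormalQuantile (u : ℝ) : ℝ :=
  sInf {x : ℝ | u ≤ normalCdf 0 1 x}

/-! The mirror statistic. -/

/-- The common standard deviation `σ √(2 α)` of `β̂⁺ + β̂⁻` and of `β̂⁺ - β̂⁻`, that is, `σ` times
the norm of `ψ₁ ± ψ₂`. -/
def mirrorSd {n p : ℕ} (X : Matrix (Fin n) (Fin p) ℝ) (σ : ℝ) (S : Finset (Fin p)) (j : Fin p)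
    (z : Fin n → ℝ) : ℝ :=
  σ * Real.sqrt (2 * mirrorAlpha X S j z)

/-- The mirror statistic of the variable `j`, for the selected set `S` and the signs `s`. -/
def mirrorStat {n p : ℕ} (X : Matrix (Fin n) (Fin p) ℝ) (lam σ : ℝ) (S : Finset (Fin p))
    (s : {k // k ∈ S} → ℝ) (j : Fin p) (z y : Fin n → ℝ) : ℝ :=
  |mirrorSd X σ S j z * stdNormalQuantile
      (truncNormalCdf 0 (mirrorSd X σ S j z)
        (truncLower (activeDir X S s j z) (activeBound X lam S s) (activeMat X S s)
          (mirrorAlpha X S j z) (mirrorResidual X S j z y))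
        (truncUpper (activeDir X S s j z) (activeBound X lam S s) (activeMat X S s)
          (mirrorAlpha X S j z) (mirrorResidual X S j z y))
        (betaPlus X S j z y + betaMinus X S j z y))| -
  |mirrorSd X σ S j z * stdNormalQuantile
      (truncNormalCdf 0 (mirrorSd X σ S j z)
        (truncLower (inactiveDir X lam S j z) (inactiveBound X S s) (inactiveMat X lam S)
          (mirrorAlpha X S j z) (mirrorResidual X S j z y))
        (truncUpper (inactiveDir X lam S j z) (inactiveBound X S s) (inactiveMat X lam S)
          (mirrorAlpha X S j z) (mirrorResidual X S j z y))
        (betaPlus X S j z y - betaMinus X S j z y))|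

/-- The mirror statistic of the variable `j` computed from the data `y` and the simulated vector
`z`: the lasso is fitted to `(X, y)`, and the mirror statistic for the selected set and signs is
evaluated at `y`. It is `0` if the lasso does not select `j`. -/
def lassoMirrorStat {n p : ℕ} (X : Matrix (Fin n) (Fin p) ℝ) (lam σ : ℝ) (j : Fin p)
    (z y : Fin n → ℝ) : ℝ :=
  if j ∈ lassoSet X lam y then
    mirrorStat X lam σ (lassoSet X lam y) (lassoSign X lam y (lassoSet X lam y)) j z y
  else 0

/-! Conditions on the design and on the coefficients. -/

/-- Every column is centered and satisfies `‖x_j‖₂² / n = 1`. -/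
def IsNormalizedDesign {n p : ℕ} (X : Matrix (Fin n) (Fin p) ℝ) : Prop :=
  ∀ j, ∑ i, X i j = 0 ∧ (1 / n : ℝ) * ∑ i, X i j ^ 2 = 1

/-- The compatibility condition with constant `φ₀`, for vectors in the cone
`‖a_{S₀}‖₁ ≤ 3 ‖a_{S₁}‖₁`, where `S₁` is the set of indices of the nonzero entries of `β` and
`S₀` is its complement. -/
def CompatibilityCondition {n p : ℕ} (X : Matrix (Fin n) (Fin p) ℝ) (β : Fin p → ℝ)
    (φ₀ : ℝ) : Prop :=
  ∀ a : Fin p → ℝ, ∑ k ∈ (activeSet β)ᶜ, |a k| ≤ 3 * ∑ k ∈ activeSet β, |a k| →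
    (∑ k ∈ activeSet β, |a k|) ^ 2 ≤
      ((activeSet β).card / φ₀ ^ 2 : ℝ) * ((1 / n : ℝ) * ((X *ᵥ a) ⬝ᵥ (X *ᵥ a)))

/-- All nonzero coefficients are larger than `64 σ |S₁| φ₀⁻² √(log p / n)` in absolute value. -/
def SignalStrength {p : ℕ} (n : ℕ) (β : Fin p → ℝ) (σ φ₀ : ℝ) : Prop :=
  ∀ j ∈ activeSet β,
    64 * σ * (activeSet β).card / φ₀ ^ 2 * Real.sqrt (Real.log p / n) < |β j|

end

end GaussianMirror

/-!
Fix a selection outcome `(S, s)` and put `u = (I - P_{S∖j}) x_j`. The vectors `ψ₁ + ψ₂ = u / ‖u‖²`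
(`sumContrast`) and `ψ₁ - ψ₂ = z̃ / (‖u‖ ‖z̃‖)` (`diffContrast`) are orthogonal and have the same
norm `1 / ‖u‖`, which does not depend on `z`. If `β_j = 0` and `S` contains the true signals, then
the mean `X β` lies in the span of `X_{S∖j}` and is orthogonal to both contrasts. Hence, given
`z`, `β̂⁺ + β̂⁻` and `β̂⁺ - β̂⁻` are independent `N(0, τ²)` variables that are independent of the
residual `r`.

By the Karush-Kuhn-Tucker conditions (`isLassoSolution_iff`), the outcome `(S, s)` is the
polyhedron `A₁ y < b₁`, `A₀ y ≤ b₀` (`lassoSet_lassoSign_iff`); the selected columns are linearly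
independent because the solution is unique (`hasIndepCols_activeSet`). The constraints `A₁`
involve, besides `r`, only the sum `β̂⁺ + β̂⁻`, and `A₀` only the difference. So given `r` and the
outcome the sum and the difference are independent truncated normal variables, and the probability
integral transform (`map_normalCdf_gaussianReal`) turns their scores into two variables of the
same law. The difference of the absolute values of the scores is therefore symmetric
(`pivotStat_symm`).

Conditioning on `r` is replaced by resampling: the law of the noise does not change if its
components along the two contrasts are replaced by fresh independent Gaussian ones
(`map_resample_pi_gaussianReal`), and then Fubini's theorem reduces the symmetry to rectangles in
the plane (`prod_rectangle_abs_sub_abs_symm`). A second use of Fubini integrates over `z` in an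
arbitrary measurable set, which is what the identity of conditional probabilities requires
(`measure_outcome_symm`, `condProb_cond_congr`). The event that all true signals are selected is a
finite disjoint union of outcomes. The exceptional `z` with `z̃ = 0` form a null set because the
columns are centered (`ae_zTilde_ne_zero`).

The probability of screening follows from the basic inequality of the lasso, the compatibility
condition and a union bound for the Gaussian tails of `x_kᵀ ε`
(`le_measureReal_activeSet_subset_lassoSet`).
-/

namespace GaussianMirror

/-! ### Spherical Gaussian vectors -/

/-- The characteristic function of a spherical Gaussian vector. -/
theorem integral_cexp_dotProduct_pi_gaussianReal {ι : Type*} [Fintype ι] (v : NNReal)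
    (w : ι → ℝ) :
    ∫ x, Complex.exp ((w ⬝ᵥ x : ℝ) * Complex.I) ∂(Measure.pi fun _ : ι => gaussianReal 0 v) =
      Complex.exp (-((v * (w ⬝ᵥ w) : ℝ) : ℂ) / 2) := by
  have h1 : ∀ x : ι → ℝ, Complex.exp ((w ⬝ᵥ x : ℝ) * Complex.I) =
      ∏ i, Complex.exp ((w i : ℂ) * (x i : ℂ) * Complex.I) := by
    intro x
    rw [← Complex.exp_sum, ← Finset.sum_mul]
    simp [dotProduct]
  simp_rw [h1]
  rw [integral_fintype_prod_eq_prod (f := fun i (x : ℝ) =>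
    Complex.exp ((w i : ℂ) * (x : ℂ) * Complex.I))]
  simp_rw [← charFun_apply_real, charFun_gaussianReal]
  rw [← Complex.exp_sum]
  congr 1
  simp only [Complex.ofReal_zero, mul_zero, zero_mul, zero_sub, dotProduct]
  push_cast
  rw [Finset.mul_sum, neg_div, Finset.sum_neg_distrib, Finset.sum_div]
  congr 1
  refine Finset.sum_congr rfl fun i _ => ?_
  ring

theorem map_dotProduct_pi_gaussianReal {ι : Type*} [Fintype ι] (v : NNReal) (w : ι → ℝ) :
    (Measure.pi fun _ : ι => gaussianReal 0 v).map (fun x => w ⬝ᵥ x) =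
      gaussianReal 0 (v * (w ⬝ᵥ w).toNNReal) := by
  have hm : Measurable fun x : ι → ℝ => w ⬝ᵥ x := by unfold dotProduct; fun_prop
  have : IsProbabilityMeasure
      ((Measure.pi fun _ : ι => gaussianReal 0 v).map (fun x => w ⬝ᵥ x)) :=
    Measure.isProbabilityMeasure_map hm.aemeasurable
  refine Measure.ext_of_charFun ?_
  ext t
  rw [charFun_apply_real, charFun_gaussianReal, integral_map hm.aemeasurable (by fun_prop)]
  have h1 : ∀ x : ι → ℝ, (t : ℂ) * ((w ⬝ᵥ x : ℝ) : ℂ) = (((t • w) ⬝ᵥ x : ℝ) : ℂ) := by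
    intro x
    rw [smul_dotProduct]
    simp
  simp_rw [h1]
  rw [integral_cexp_dotProduct_pi_gaussianReal]
  congr 1
  have h0 : 0 ≤ w ⬝ᵥ w := dotProduct_self_star_nonneg w
  simp only [smul_dotProduct, dotProduct_smul, NNReal.coe_mul, Real.coe_toNNReal _ h0, smul_eq_mul]
  push_cast
  ring

/-- Resampling two orthogonal coordinates: if `v₁`, `v₂` are orthogonal of equal squared norm `κ`,
replacing the projection of a spherical Gaussian vector to their span by
independent Gaussian coordinates `a`, `b` (the values of the inner products with `v₁`, `v₂`) does
not change its law. -/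
theorem map_resample_pi_gaussianReal {ι : Type*} [Fintype ι] (v : NNReal) {v₁ v₂ : ι → ℝ} {κ : ℝ}
    (hκ : 0 < κ) (h₁ : v₁ ⬝ᵥ v₁ = κ) (h₂ : v₂ ⬝ᵥ v₂ = κ) (h₁₂ : v₁ ⬝ᵥ v₂ = 0) :
    ((Measure.pi fun _ : ι => gaussianReal 0 v).prod
        ((gaussianReal 0 (v * κ.toNNReal)).prod (gaussianReal 0 (v * κ.toNNReal)))).map
      (fun q : (ι → ℝ) × ℝ × ℝ =>
        q.1 - κ⁻¹ • ((v₁ ⬝ᵥ q.1) • v₁ + (v₂ ⬝ᵥ q.1) • v₂) + κ⁻¹ • (q.2.1 • v₁ + q.2.2 • v₂)) =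
      Measure.pi fun _ : ι => gaussianReal 0 v := by
  classical
  have hm : Measurable (fun q : (ι → ℝ) × ℝ × ℝ =>
        q.1 - κ⁻¹ • ((v₁ ⬝ᵥ q.1) • v₁ + (v₂ ⬝ᵥ q.1) • v₂) +
          κ⁻¹ • (q.2.1 • v₁ + q.2.2 • v₂)) := by
    unfold dotProduct; fun_prop
  have := Measure.isProbabilityMeasure_map (μ := (Measure.pi fun _ : ι => gaussianReal 0 v).prod
        ((gaussianReal 0 (v * κ.toNNReal)).prod (gaussianReal 0 (v * κ.toNNReal)))) hm.aemeasurable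
  refine Measure.ext_of_charFunDual ?_
  ext L
  -- every continuous linear functional is the inner product with a vector `w`
  obtain ⟨w, hw⟩ : ∃ w : ι → ℝ, ∀ x, L x = w ⬝ᵥ x := by
    refine ⟨fun i => L (Pi.single i 1), fun x => ?_⟩
    have := LinearMap.pi_apply_eq_sum_univ (L : (ι → ℝ) →ₗ[ℝ] ℝ) x
    simp only [ContinuousLinearMap.coe_coe] at this
    rw [this, dotProduct]
    refine Finset.sum_congr rfl fun i _ => ?_
    rw [smul_eq_mul, mul_comm]
    congr 3
    ext k
    simp [Pi.single_apply, eq_comm]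
  rw [charFunDual_apply, charFunDual_apply, integral_map hm.aemeasurable (by fun_prop)]
  simp_rw [hw]
  rw [integral_cexp_dotProduct_pi_gaussianReal]
  set d₁ := w ⬝ᵥ v₁ with hd₁
  set d₂ := w ⬝ᵥ v₂ with hd₂
  have key : ∀ q : (ι → ℝ) × ℝ × ℝ, Complex.exp (((w ⬝ᵥ (q.1 - κ⁻¹ • ((v₁ ⬝ᵥ q.1) • v₁ +
      (v₂ ⬝ᵥ q.1) • v₂) + κ⁻¹ • (q.2.1 • v₁ + q.2.2 • v₂)) : ℝ) : ℂ) * Complex.I) =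
      Complex.exp ((((w - κ⁻¹ • (d₁ • v₁ + d₂ • v₂)) ⬝ᵥ q.1 : ℝ) : ℂ) * Complex.I) *
      (Complex.exp (((κ⁻¹ * d₁ : ℝ) : ℂ) * (q.2.1 : ℂ) * Complex.I) *
        Complex.exp (((κ⁻¹ * d₂ : ℝ) : ℂ) * (q.2.2 : ℂ) * Complex.I)) := by
    intro q
    rw [← Complex.exp_add, ← Complex.exp_add]
    congr 1
    simp only [dotProduct_add, dotProduct_sub, dotProduct_smul, sub_dotProduct, smul_dotProduct,
      add_dotProduct, ← hd₁, ← hd₂, smul_eq_mul]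
    push_cast
    ring
  simp_rw [key]
  rw [integral_prod_mul (f := fun x : ι → ℝ => Complex.exp ((((w - κ⁻¹ • (d₁ • v₁ + d₂ • v₂)) ⬝ᵥ x
    : ℝ) : ℂ) * Complex.I)) (g := fun q : ℝ × ℝ =>
      (Complex.exp (((κ⁻¹ * d₁ : ℝ) : ℂ) * (q.1 : ℂ) * Complex.I) *
        Complex.exp (((κ⁻¹ * d₂ : ℝ) : ℂ) * (q.2 : ℂ) * Complex.I))),
    integral_prod_mul (f := fun x : ℝ => Complex.exp (((κ⁻¹ * d₁ : ℝ) : ℂ) * (x : ℂ) * Complex.I))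
      (g := fun x : ℝ => Complex.exp (((κ⁻¹ * d₂ : ℝ) : ℂ) * (x : ℂ) * Complex.I)),
    integral_cexp_dotProduct_pi_gaussianReal, ← charFun_apply_real, ← charFun_apply_real,
    charFun_gaussianReal, charFun_gaussianReal, ← Complex.exp_add, ← Complex.exp_add]
  congr 1
  have e : (w - κ⁻¹ • (d₁ • v₁ + d₂ • v₂)) ⬝ᵥ (w - κ⁻¹ • (d₁ • v₁ + d₂ • v₂)) =
      w ⬝ᵥ w - κ⁻¹ * (d₁ ^ 2 + d₂ ^ 2) := by
    simp only [dotProduct_add, dotProduct_sub, dotProduct_smul, sub_dotProduct, smul_dotProduct,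
      add_dotProduct, smul_eq_mul, h₁, h₂, h₁₂, dotProduct_comm v₂ v₁, dotProduct_comm v₁ w,
      dotProduct_comm v₂ w, ← hd₁, ← hd₂]
    field_simp
    ring
  rw [e]
  have hκ' : (κ : ℂ) ≠ 0 := by exact_mod_cast hκ.ne'
  simp only [NNReal.coe_mul, Real.coe_toNNReal _ hκ.le]
  push_cast
  field_simp
  ring

/-! ### The probability integral transform -/

theorem toNNReal_sq_ne_zero {τ : ℝ} (hτ : 0 < τ) : (τ ^ 2).toNNReal ≠ 0 := by
  have : 0 < τ ^ 2 := by positivity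
  simpa [Real.toNNReal_eq_zero, not_le] using hτ.ne'

theorem normalCdf_coe (m τ x : ℝ) :
    normalCdf m τ (x : EReal) = cdf (gaussianReal m (τ ^ 2).toNNReal) x := by
  rw [cdf_eq_real, normalCdf]
  congr 1
  ext u
  simp

theorem monotone_normalCdf (m τ : ℝ) : Monotone (normalCdf m τ) := fun x y h =>
  measureReal_mono (fun _ hu => le_trans hu h)

theorem measurable_normalCdf (m τ : ℝ) : Measurable (normalCdf m τ) :=
  (monotone_normalCdf m τ).measurable

theorem strictMono_normalCdf (m : ℝ) {τ : ℝ} (hτ : 0 < τ) : StrictMono (normalCdf m τ) := by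
  intro x y hxy
  obtain ⟨u, hxu, huy⟩ := EReal.lt_iff_exists_real_btwn.1 hxy
  obtain ⟨w, huw, hwy⟩ := EReal.lt_iff_exists_real_btwn.1 huy
  have huw' : u < w := by exact_mod_cast huw
  have hpos : 0 < (gaussianReal m (τ ^ 2).toNNReal).real (Set.Ioc u w) := by
    rw [measureReal_def, ENNReal.toReal_pos_iff]
    refine ⟨pos_iff_ne_zero.2 fun h0 => ?_, measure_lt_top _ _⟩
    have := gaussianReal_absolutelyContinuous' m (toNNReal_sq_ne_zero hτ) h0
    simp [Real.volume_Ioc] at this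
    linarith
  have hsub : {r : ℝ | (r : EReal) ≤ x} ∪ Set.Ioc u w ⊆ {r : ℝ | (r : EReal) ≤ y} := by
    rintro r (hr | hr)
    · exact le_trans hr hxy.le
    · exact le_trans (by exact_mod_cast hr.2) hwy.le
  have hd : Disjoint {r : ℝ | (r : EReal) ≤ x} (Set.Ioc u w) := by
    rw [Set.disjoint_left]
    intro r hr hr'
    have h1 : (r : EReal) < u := lt_of_le_of_lt hr hxu
    have h2 : r < u := by exact_mod_cast h1
    exact absurd hr'.1 (not_lt.2 h2.le)
  have := measureReal_mono (μ := gaussianReal m (τ ^ 2).toNNReal) hsub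
  rw [measureReal_union hd measurableSet_Ioc] at this
  simp only [normalCdf]
  linarith

theorem continuous_cdf_of_nullSingletonClass (ν : Measure ℝ) [IsProbabilityMeasure ν]
    [NullSingletonClass ν] : Continuous (cdf ν) := by
  rw [continuous_iff_continuousAt]
  intro x
  rw [(monotone_cdf ν).continuousAt_iff_leftLim_eq_rightLim, StieltjesFunction.rightLim_eq]
  refine le_antisymm ((monotone_cdf ν).leftLim_le le_rfl) ?_
  have h := (cdf ν).measure_singleton x
  rw [measure_cdf, measure_singleton] at h
  have := ENNReal.ofReal_eq_zero.1 h.symm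
  linarith

theorem normalCdf_mem_Icc (m τ : ℝ) (x : EReal) : normalCdf m τ x ∈ Set.Icc 0 1 :=
  ⟨measureReal_nonneg, measureReal_le_one⟩

/-- The probability integral transform. -/
theorem map_normalCdf_gaussianReal (m : ℝ) {τ : ℝ} (hτ : 0 < τ) :
    (gaussianReal m (τ ^ 2).toNNReal).map (fun x : ℝ => normalCdf m τ x) =
      volume.restrict (Set.Icc 0 1) := by
  have hmeas : Measurable fun x : ℝ => normalCdf m τ x :=
    (measurable_normalCdf m τ).comp measurable_coe_real_ereal
  have := Measure.isProbabilityMeasure_map (μ := gaussianReal m (τ ^ 2).toNNReal)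
    hmeas.aemeasurable
  have := nullSingletonClass_gaussianReal (μ := m) (toNNReal_sq_ne_zero hτ)
  refine Measure.ext_of_Iic _ _ fun w => ?_
  rw [Measure.map_apply hmeas measurableSet_Iic, Measure.restrict_apply measurableSet_Iic]
  rcases le_or_gt w 0 with hw | hw
  · have h1 : (fun x : ℝ => normalCdf m τ x) ⁻¹' Set.Iic w = ∅ := by
      ext x
      simp only [Set.mem_preimage, Set.mem_Iic, Set.mem_empty_iff_false, iff_false, not_le]
      have := strictMono_normalCdf m hτ (EReal.bot_lt_coe x)
      have h0 := (normalCdf_mem_Icc m τ ⊥).1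
      linarith
    have h2 : Set.Iic w ∩ Set.Icc (0 : ℝ) 1 ⊆ {0} := by
      rintro x ⟨hx, hx'⟩
      exact le_antisymm (le_trans hx hw) hx'.1
    rw [h1, measure_empty, measure_mono_null h2 (by simp)]
  rcases le_or_gt 1 w with hw1 | hw1
  · have h1 : (fun x : ℝ => normalCdf m τ x) ⁻¹' Set.Iic w = Set.univ :=
      Set.eq_univ_of_forall fun x => (normalCdf_mem_Icc m τ x).2.trans hw1
    have h2 : Set.Iic w ∩ Set.Icc (0 : ℝ) 1 = Set.Icc 0 1 :=
      Set.inter_eq_right.2 fun x hx => hx.2.trans hw1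
    rw [h1, h2]
    simp
  · obtain ⟨x₀, hx₀⟩ : ∃ x₀ : ℝ, normalCdf m τ x₀ = w := by
      simp_rw [normalCdf_coe]
      exact mem_range_of_exists_le_of_exists_ge
        (continuous_cdf_of_nullSingletonClass _)
        (((tendsto_cdf_atBot (gaussianReal m (τ ^ 2).toNNReal)).eventually
          (ge_mem_nhds hw)).exists)
        (((tendsto_cdf_atTop (gaussianReal m (τ ^ 2).toNNReal)).eventually
          (le_mem_nhds hw1)).exists)
    have h1 : (fun x : ℝ => normalCdf m τ x) ⁻¹' Set.Iic w = Set.Iic x₀ := by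
      ext x
      simp only [Set.mem_preimage, Set.mem_Iic, ← hx₀, (strictMono_normalCdf m hτ).le_iff_le,
        EReal.coe_le_coe_iff]
    have h2 : Set.Iic w ∩ Set.Icc (0 : ℝ) 1 = Set.Icc 0 w := by
      ext x
      simp only [Set.mem_inter_iff, Set.mem_Iic, Set.mem_Icc]
      constructor
      · rintro ⟨a, b, c⟩; exact ⟨b, a⟩
      · rintro ⟨a, b⟩; exact ⟨b, a, b.trans hw1.le⟩
    rw [h1, h2, ← ofReal_cdf, ← normalCdf_coe, hx₀]
    simp

/-- The truncated distribution function transforms the normal distribution, restricted to the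
truncation interval, to a multiple of the uniform distribution. -/
theorem exists_map_truncNormalCdf_restrict (m : ℝ) {τ : ℝ} (hτ : 0 < τ) (a b : EReal) :
    ∃ c : NNReal, ((gaussianReal m (τ ^ 2).toNNReal).restrict
      {x : ℝ | a ≤ x ∧ (x : EReal) ≤ b}).map (truncNormalCdf m τ a b) =
        c • volume.restrict (Set.Icc 0 1) := by
  have hmeas : Measurable fun x : ℝ => normalCdf m τ x :=
    (measurable_normalCdf m τ).comp measurable_coe_real_ereal
  -- for `b ≤ a` the interval has at most one point, so that it is a null set
  rcases le_or_gt b a with hab | hab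
  · refine ⟨0, ?_⟩
    have := nullSingletonClass_gaussianReal (μ := m) (toNNReal_sq_ne_zero hτ)
    have hs : {x : ℝ | a ≤ x ∧ (x : EReal) ≤ b}.Subsingleton := by
      intro x hx y hy
      have h1 : (x : EReal) ≤ y := hx.2.trans (hab.trans hy.1)
      have h2 : (y : EReal) ≤ x := hy.2.trans (hab.trans hx.1)
      exact_mod_cast le_antisymm h1 h2
    rw [Measure.restrict_eq_zero.2 (hs.measure_zero _)]
    simp
  set A := normalCdf m τ a with hA
  set B := normalCdf m τ b with hB
  have hAB : A < B := strictMono_normalCdf m hτ hab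
  have hd : 0 < B - A := sub_pos.2 hAB
  refine ⟨(B - A).toNNReal, ?_⟩
  have hI : {x : ℝ | a ≤ x ∧ (x : EReal) ≤ b} =
      (fun x : ℝ => normalCdf m τ x) ⁻¹' Set.Icc A B := by
    ext x
    simp [hA, hB, (strictMono_normalCdf m hτ).le_iff_le]
  have hcomp : truncNormalCdf m τ a b =
      (fun t => (B - A)⁻¹ * t + (-A / (B - A))) ∘ fun x : ℝ => normalCdf m τ x := by
    ext x
    simp only [truncNormalCdf, Function.comp, ← hA, ← hB]
    field_simp
    ring
  rw [hI, hcomp, ← Measure.map_map (by fun_prop) hmeas, ← Measure.restrict_map hmeas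
    measurableSet_Icc, map_normalCdf_gaussianReal m hτ, Measure.restrict_restrict measurableSet_Icc,
    Set.inter_eq_left.2 (Set.Icc_subset_Icc (normalCdf_mem_Icc m τ a).1
      (normalCdf_mem_Icc m τ b).2)]
  have hpre : Set.Icc A B = (fun t => (B - A)⁻¹ * t + (-A / (B - A))) ⁻¹' Set.Icc 0 1 := by
    ext t
    have e : (B - A)⁻¹ * t + (-A / (B - A)) = (t - A) / (B - A) := by field_simp; ring
    simp only [Set.mem_Icc, Set.mem_preimage, e, le_div_iff₀ hd, zero_mul, div_le_one hd]
    constructor <;> rintro ⟨h1, h2⟩ <;> constructor <;> linarith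
  have hvol : (volume : Measure ℝ).map (fun t => (B - A)⁻¹ * t + (-A / (B - A))) =
      (B - A).toNNReal • volume := by
    have : (fun t => (B - A)⁻¹ * t + (-A / (B - A))) =
      (fun t => t + (-A / (B - A))) ∘ (fun t => (B - A)⁻¹ * t) := rfl
    rw [this, ← Measure.map_map (by fun_prop) (by fun_prop),
      Real.map_volume_mul_left (inv_ne_zero hd.ne'), Measure.map_smul, map_add_right_eq_self,
      inv_inv, abs_of_pos hd]
    rfl
  rw [hpre, ← Measure.restrict_map (by fun_prop) measurableSet_Icc, hvol]
  simp

/-! ### The quantile function -/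

/-- Outside `(0, 1)` the defining infimum runs over the whole line or over the empty set, and has
the default value `0`. -/
theorem stdNormalQuantile_of_notMem {u : ℝ} (hu : u ∉ Set.Ioo 0 1) : stdNormalQuantile u = 0 := by
  unfold stdNormalQuantile
  rw [Set.mem_Ioo, not_and_or, not_lt, not_lt] at hu
  rcases hu with hu | hu
  · have : {x : ℝ | u ≤ normalCdf 0 1 x} = Set.univ :=
      Set.eq_univ_of_forall fun x => hu.trans (normalCdf_mem_Icc 0 1 x).1
    rw [this, Real.sInf_univ]
  · have : {x : ℝ | u ≤ normalCdf 0 1 x} = ∅ := by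
      ext x
      simp only [Set.mem_ofPred_eq, Set.mem_empty_iff_false, iff_false, not_le]
      exact (strictMono_normalCdf 0 one_pos (EReal.coe_lt_top x)).trans_le
        ((normalCdf_mem_Icc 0 1 ⊤).2.trans hu)
    rw [this, Real.sInf_empty]

theorem monotoneOn_stdNormalQuantile : MonotoneOn stdNormalQuantile (Set.Ioo 0 1) := by
  intro u hu w hw huw
  refine csInf_le_csInf ?_ ?_ fun x hx => huw.trans hx
  · obtain ⟨x₀, hx₀⟩ := ((tendsto_cdf_atBot (gaussianReal 0 ((1 : ℝ) ^ 2).toNNReal)).eventually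
      (gt_mem_nhds hu.1)).exists
    rw [← normalCdf_coe] at hx₀
    refine ⟨x₀, fun x hx => ?_⟩
    have := (strictMono_normalCdf 0 one_pos).lt_iff_lt.1 (lt_of_lt_of_le hx₀ hx)
    exact_mod_cast this.le
  · obtain ⟨x₀, hx₀⟩ := ((tendsto_cdf_atTop (gaussianReal 0 ((1 : ℝ) ^ 2).toNNReal)).eventually
      (lt_mem_nhds hw.2)).exists
    rw [← normalCdf_coe] at hx₀
    exact ⟨x₀, hx₀.le⟩

theorem measurable_stdNormalQuantile : Measurable stdNormalQuantile := by
  refine measurable_of_restrict_of_restrict_compl (s := Set.Ioo 0 1) measurableSet_Ioo ?_ ?_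
  · refine Monotone.measurable fun u w h => ?_
    exact monotoneOn_stdNormalQuantile u.2 w.2 h
  · have : Set.domRestrict (Set.Ioo 0 1)ᶜ stdNormalQuantile = fun _ => 0 := by
      ext u
      exact stdNormalQuantile_of_notMem u.2
    rw [this]
    exact measurable_const

theorem measurable_truncNormalCdf {Ω : Type*} [MeasurableSpace Ω] (m τ : ℝ) {a b : Ω → EReal}
    {x : Ω → ℝ} (ha : Measurable a) (hb : Measurable b) (hx : Measurable x) :
    Measurable fun ω => truncNormalCdf m τ (a ω) (b ω) (x ω) := by
  have h1 := (measurable_normalCdf m τ).comp (measurable_coe_real_ereal.comp hx)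
  have h2 := (measurable_normalCdf m τ).comp ha
  have h3 := (measurable_normalCdf m τ).comp hb
  exact (h1.sub h2).div (h3.sub h2)

/-! ### Linear constraints on a normal variable -/

theorem forall_mul_le_iff {ι : Type*} (a c : ι → ℝ) (x : ℝ) :
    (∀ i, a i * x ≤ c i) ↔
      ((⨆ i, ⨆ _ : a i < 0, ((c i / a i : ℝ) : EReal)) ≤ x ∧
        (x : EReal) ≤ ⨅ i, ⨅ _ : 0 < a i, ((c i / a i : ℝ) : EReal)) ∧
      ∀ i, a i = 0 → 0 ≤ c i := by
  simp only [iSup_le_iff, le_iInf_iff, EReal.coe_le_coe_iff]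
  constructor
  · intro h
    refine ⟨⟨fun i hi => ?_, fun i hi => ?_⟩, fun i hi => ?_⟩
    · rw [div_le_iff_of_neg hi, mul_comm]; exact h i
    · rw [le_div_iff₀ hi, mul_comm]; exact h i
    · simpa [hi] using h i
  · rintro ⟨⟨h1, h2⟩, h3⟩ i
    rcases lt_trichotomy (a i) 0 with hi | hi | hi
    · have := h1 i hi; rwa [div_le_iff_of_neg hi, mul_comm] at this
    · simpa [hi] using h3 i hi
    · have := h2 i hi; rwa [le_div_iff₀ hi, mul_comm] at this

/-- If all constraints with zero slope hold, the constraints cut out the truncation interval;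
otherwise they are contradictory, and the multiple is zero. -/
theorem exists_map_truncNormalCdf_restrict_le {ι : Type*} {τ : ℝ} (hτ : 0 < τ) (a c : ι → ℝ) :
    ∃ k : NNReal, ((gaussianReal 0 (τ ^ 2).toNNReal).restrict {x : ℝ | ∀ i, a i * x ≤ c i}).map
      (truncNormalCdf 0 τ (⨆ i, ⨆ _ : a i < 0, ((c i / a i : ℝ) : EReal))
        (⨅ i, ⨅ _ : 0 < a i, ((c i / a i : ℝ) : EReal))) = k • volume.restrict (Set.Icc 0 1) := by
  simp_rw [forall_mul_le_iff]
  by_cases h : ∀ i, a i = 0 → 0 ≤ c i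
  · simp only [eq_true h, and_true]
    exact exists_map_truncNormalCdf_restrict 0 hτ _ _
  · exact ⟨0, by simp [h]⟩

/-- Strict constraints differ from weak ones by finitely many points, unless a constraint with zero
slope is violated. -/
theorem exists_map_truncNormalCdf_restrict_lt {ι : Type*} [Finite ι] {τ : ℝ} (hτ : 0 < τ)
    (a c : ι → ℝ) :
    ∃ k : NNReal, ((gaussianReal 0 (τ ^ 2).toNNReal).restrict {x : ℝ | ∀ i, a i * x < c i}).map
      (truncNormalCdf 0 τ (⨆ i, ⨆ _ : a i < 0, ((c i / a i : ℝ) : EReal))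
        (⨅ i, ⨅ _ : 0 < a i, ((c i / a i : ℝ) : EReal))) = k • volume.restrict (Set.Icc 0 1) := by
  by_cases h : ∀ i, a i = 0 → 0 < c i
  · have := nullSingletonClass_gaussianReal (μ := 0) (toNNReal_sq_ne_zero hτ)
    have hfin : (Set.range fun i => c i / a i).Finite := Set.finite_range _
    have hae : ({x : ℝ | ∀ i, a i * x < c i} : Set ℝ) =ᵐ[gaussianReal 0 (τ ^ 2).toNNReal]
        {x : ℝ | ∀ i, a i * x ≤ c i} := by
      have hn : ∀ᵐ x ∂gaussianReal 0 (τ ^ 2).toNNReal, x ∉ Set.range fun i => c i / a i :=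
        measure_eq_zero_iff_ae_notMem.1 (hfin.measure_zero _)
      filter_upwards [hn] with x hx
      refine propext ⟨fun hx i => (hx i).le, fun h' i => lt_of_le_of_ne (h' i) fun he => ?_⟩
      rcases eq_or_ne (a i) 0 with hi | hi
      · have := h i hi
        rw [hi, zero_mul] at he
        exact this.ne he
      · exact hx ⟨i, by simp only; rw [← he]; field_simp⟩
    rw [Measure.restrict_congr_set hae]
    exact exists_map_truncNormalCdf_restrict_le hτ a c
  · have : {x : ℝ | ∀ i, a i * x < c i} = ∅ := by
      push Not at h
      obtain ⟨i, hi, hc⟩ := h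
      ext x
      simp only [Set.mem_ofPred_eq, Set.mem_empty_iff_false, iff_false, not_forall, not_lt]
      exact ⟨i, by simpa [hi] using hc⟩
    exact ⟨0, by simp [this]⟩

/-- If two measurable functions push `ν`, restricted to `J₁` and to `J₀`, to multiples of the
same law, then on the rectangle `J₁ × J₀` the difference of their absolute values is symmetric. -/
theorem prod_rectangle_abs_sub_abs_symm {ν L : Measure ℝ} [IsFiniteMeasure ν] [IsFiniteMeasure L]
    {J₁ J₀ : Set ℝ} {G₁ G₀ : ℝ → ℝ} (hG₁ : Measurable G₁) (hG₀ : Measurable G₀) {k₁ k₀ : NNReal}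
    (h₁ : (ν.restrict J₁).map G₁ = k₁ • L) (h₀ : (ν.restrict J₀).map G₀ = k₀ • L) (t : ℝ) :
    (ν.prod ν) {q | (q.1 ∈ J₁ ∧ q.2 ∈ J₀) ∧ |G₁ q.1| - |G₀ q.2| ≤ -t} =
      (ν.prod ν) {q | (q.1 ∈ J₁ ∧ q.2 ∈ J₀) ∧ t ≤ |G₁ q.1| - |G₀ q.2|} := by
  have key : ∀ s : Set ℝ, MeasurableSet s →
      (ν.prod ν) {q | (q.1 ∈ J₁ ∧ q.2 ∈ J₀) ∧ |G₁ q.1| - |G₀ q.2| ∈ s} =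
        (k₁ * k₀ : NNReal) • (L.prod L) {q | |q.1| - |q.2| ∈ s} := by
    intro s hs
    have hm : MeasurableSet {q : ℝ × ℝ | |q.1| - |q.2| ∈ s} := by
      refine measurableSet_preimage (f := fun q : ℝ × ℝ => |q.1| - |q.2|) ?_ hs
      exact (continuous_fst.abs.sub continuous_snd.abs).measurable
    have e1 : {q : ℝ × ℝ | (q.1 ∈ J₁ ∧ q.2 ∈ J₀) ∧ |G₁ q.1| - |G₀ q.2| ∈ s} =
        Prod.map G₁ G₀ ⁻¹' {q | |q.1| - |q.2| ∈ s} ∩ J₁ ×ˢ J₀ := by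
      ext q
      simp [and_comm]
    rw [e1, ← Measure.restrict_apply ((hG₁.prodMap hG₀) hm), ← Measure.prod_restrict,
      ← Measure.map_apply (hG₁.prodMap hG₀) hm, ← Measure.map_prod_map _ _ hG₁ hG₀, h₁, h₀]
    simp only [Measure.smul_apply, Measure.prod_smul_left, Measure.prod_smul_right, mul_smul]
    rw [smul_comm]
  have hle := key (Set.Iic (-t)) measurableSet_Iic
  have hge := key (Set.Ici t) measurableSet_Ici
  simp only [Set.mem_Iic, Set.mem_Ici] at hle hge
  rw [hle, hge]
  congr 1
  have hm : MeasurableSet {q : ℝ × ℝ | t ≤ |q.1| - |q.2|} :=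
    measurableSet_le measurable_const
      (continuous_fst.abs.sub continuous_snd.abs).measurable
  conv_rhs => rw [← Measure.prod_swap, Measure.map_apply measurable_swap hm]
  congr 1
  ext q
  simp only [Set.mem_ofPred_eq, Set.mem_preimage, Prod.fst_swap, Prod.snd_swap]
  constructor <;> intro h <;> linarith

/-! ### The mirror statistic as a function of two contrasts -/

/-- The score of the value `x` for constraints `A y ≤ b` with direction `a` and residual `r`: the
`N(0, τ²)`-quantile at the level given by the normal distribution function truncated to the
interval that the constraints allow. -/
noncomputable def truncScore {n : ℕ} {ι : Type*} (τ α : ℝ) (A : Matrix ι (Fin n) ℝ) (b a : ι → ℝ)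
    (r : Fin n → ℝ) (x : ℝ) : ℝ :=
  τ * stdNormalQuantile (truncNormalCdf 0 τ (truncLower a b A α r) (truncUpper a b A α r) x)

/-- The residual of `y` after projection onto the span of orthogonal vectors `v₁`, `v₂` of
squared norm `2 α`. -/
noncomputable def pivotResidual {n : ℕ} (α : ℝ) (v₁ v₂ y : Fin n → ℝ) : Fin n → ℝ :=
  y - (2 * α)⁻¹ • ((v₁ ⬝ᵥ y) • v₁ + (v₂ ⬝ᵥ y) • v₂)

/-- The mirror statistic as a function of the two contrasts `v₁ = ψ₁ + ψ₂` and `v₂ = ψ₁ - ψ₂`. -/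
noncomputable def pivotStat {n : ℕ} {ι₁ ι₀ : Type*} (τ α : ℝ) (A₁ : Matrix ι₁ (Fin n) ℝ)
    (b₁ : ι₁ → ℝ) (A₀ : Matrix ι₀ (Fin n) ℝ) (b₀ : ι₀ → ℝ) (v₁ v₂ y : Fin n → ℝ) : ℝ :=
  |truncScore τ α A₁ b₁ (A₁ *ᵥ ((1 / 2 : ℝ) • v₁)) (pivotResidual α v₁ v₂ y) (v₁ ⬝ᵥ y)| -
    |truncScore τ α A₀ b₀ (A₀ *ᵥ ((1 / 2 : ℝ) • v₂)) (pivotResidual α v₁ v₂ y) (v₂ ⬝ᵥ y)|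

/-! ### Measurability -/

section Measurability

variable {Ω : Type*} [MeasurableSpace Ω] {n : ℕ} {ι : Type*}

theorem measurable_dotProduct {f g : Ω → Fin n → ℝ} (hf : Measurable f) (hg : Measurable g) :
    Measurable fun ω => f ω ⬝ᵥ g ω := by
  unfold dotProduct
  exact Finset.measurable_sum _ fun i _ =>
    ((measurable_pi_apply i).comp hf).mul ((measurable_pi_apply i).comp hg)

theorem measurable_mulVec_apply (A : Matrix ι (Fin n) ℝ) {f : Ω → Fin n → ℝ} (hf : Measurable f)
    (i : ι) : Measurable fun ω => (A *ᵥ f ω) i :=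
  measurable_dotProduct measurable_const hf

theorem measurable_truncLower [Countable ι] {a : Ω → ι → ℝ} (ha : Measurable a) (b : ι → ℝ)
    (A : Matrix ι (Fin n) ℝ) (α : ℝ) {r : Ω → Fin n → ℝ} (hr : Measurable r) :
    Measurable fun ω => truncLower (a ω) b A α (r ω) := by
  unfold truncLower
  refine Measurable.iSup fun i => ?_
  have hai : Measurable fun ω => a ω i := ha.eval
  have : (fun ω => ⨆ _ : a ω i < 0, ((α * (b i - (A *ᵥ r ω) i) / a ω i : ℝ) : EReal)) =
      fun ω => if a ω i < 0 then ((α * (b i - (A *ᵥ r ω) i) / a ω i : ℝ) : EReal) else ⊥ := by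
    ext ω
    rw [iSup_eq_if]
  rw [this]
  refine Measurable.ite (measurableSet_lt hai measurable_const)
    (measurable_coe_real_ereal.comp ?_) measurable_const
  exact ((measurable_const.sub (measurable_mulVec_apply A hr i)).const_mul α).div hai

theorem measurable_truncUpper [Countable ι] {a : Ω → ι → ℝ} (ha : Measurable a) (b : ι → ℝ)
    (A : Matrix ι (Fin n) ℝ) (α : ℝ) {r : Ω → Fin n → ℝ} (hr : Measurable r) :
    Measurable fun ω => truncUpper (a ω) b A α (r ω) := by
  unfold truncUpper
  refine Measurable.iInf fun i => ?_
  have hai : Measurable fun ω => a ω i := ha.eval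
  have : (fun ω => ⨅ _ : 0 < a ω i, ((α * (b i - (A *ᵥ r ω) i) / a ω i : ℝ) : EReal)) =
      fun ω => if 0 < a ω i then ((α * (b i - (A *ᵥ r ω) i) / a ω i : ℝ) : EReal) else ⊤ := by
    ext ω
    rw [iInf_eq_if]
  rw [this]
  refine Measurable.ite (measurableSet_lt measurable_const hai)
    (measurable_coe_real_ereal.comp ?_) measurable_const
  exact ((measurable_const.sub (measurable_mulVec_apply A hr i)).const_mul α).div hai

theorem measurable_truncScore [Countable ι] (τ α : ℝ) (A : Matrix ι (Fin n) ℝ) (b : ι → ℝ)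
    {a : Ω → ι → ℝ} (ha : Measurable a) {r : Ω → Fin n → ℝ} (hr : Measurable r) {x : Ω → ℝ}
    (hx : Measurable x) : Measurable fun ω => truncScore τ α A b (a ω) (r ω) (x ω) :=
  (measurable_stdNormalQuantile.comp (measurable_truncNormalCdf 0 τ
    (measurable_truncLower ha b A α hr) (measurable_truncUpper ha b A α hr) hx)).const_mul τ

theorem measurable_pivotStat {ι₁ ι₀ : Type*} [Countable ι₁] [Countable ι₀] (τ α : ℝ)
    (A₁ : Matrix ι₁ (Fin n) ℝ) (b₁ : ι₁ → ℝ) (A₀ : Matrix ι₀ (Fin n) ℝ) (b₀ : ι₀ → ℝ)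
    (v₁ : Fin n → ℝ) {v₂ y : Ω → Fin n → ℝ} (hv₂ : Measurable v₂) (hy : Measurable y) :
    Measurable fun ω => pivotStat τ α A₁ b₁ A₀ b₀ v₁ (v₂ ω) (y ω) := by
  have h1 : Measurable fun ω => v₁ ⬝ᵥ y ω := measurable_dotProduct measurable_const hy
  have h2 : Measurable fun ω => v₂ ω ⬝ᵥ y ω := measurable_dotProduct hv₂ hy
  have hr : Measurable fun ω => pivotResidual α v₁ (v₂ ω) (y ω) := by
    unfold pivotResidual
    exact hy.sub (((h1.smul_const v₁).add (h2.smul hv₂)).const_smul ((2 * α)⁻¹))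
  refine (Measurable.sub ?_ ?_)
  · exact (continuous_abs.measurable).comp
      (measurable_truncScore τ α A₁ b₁ measurable_const hr h1)
  · refine (continuous_abs.measurable).comp
      (measurable_truncScore τ α A₀ b₀ (measurable_pi_iff.2 fun i => ?_) hr h2)
    exact measurable_mulVec_apply A₀ (hv₂.const_smul (1 / 2 : ℝ)) i

theorem measurableSet_constraints {ι₁ ι₀ : Type*} [Countable ι₁] [Countable ι₀]
    (A₁ : Matrix ι₁ (Fin n) ℝ) (b₁ : ι₁ → ℝ) (A₀ : Matrix ι₀ (Fin n) ℝ) (b₀ : ι₀ → ℝ) :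
    MeasurableSet {y : Fin n → ℝ | (∀ i, (A₁ *ᵥ y) i < b₁ i) ∧ ∀ i, (A₀ *ᵥ y) i ≤ b₀ i} := by
  refine MeasurableSet.inter (s₁ := {y | ∀ i, (A₁ *ᵥ y) i < b₁ i})
    (s₂ := {y | ∀ i, (A₀ *ᵥ y) i ≤ b₀ i}) ?_ ?_
  · simp only [Set.ofPred_forall]
    exact MeasurableSet.iInter fun i => measurableSet_lt
      (measurable_mulVec_apply A₁ measurable_id i) measurable_const
  · simp only [Set.ofPred_forall]
    exact MeasurableSet.iInter fun i => measurableSet_le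
      (measurable_mulVec_apply A₀ measurable_id i) measurable_const

end Measurability

/-! ### Symmetry for fixed contrasts -/

theorem exists_map_truncScore {n : ℕ} {ι : Type*} {τ α : ℝ} (A : Matrix ι (Fin n) ℝ)
    (b a : ι → ℝ) (r : Fin n → ℝ) {J : Set ℝ} {k : NNReal}
    (h : ((gaussianReal 0 (τ ^ 2).toNNReal).restrict J).map (truncNormalCdf 0 τ
      (⨆ i, ⨆ _ : a i < 0, ((α * (b i - (A *ᵥ r) i) / a i : ℝ) : EReal))
      (⨅ i, ⨅ _ : 0 < a i, ((α * (b i - (A *ᵥ r) i) / a i : ℝ) : EReal))) =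
        k • volume.restrict (Set.Icc 0 1)) :
    ((gaussianReal 0 (τ ^ 2).toNNReal).restrict J).map (truncScore τ α A b a r) =
      k • (volume.restrict (Set.Icc 0 1)).map fun u => τ * stdNormalQuantile u := by
  rw [← Measure.map_smul, ← h, Measure.map_map]
  · rfl
  · exact measurable_stdNormalQuantile.const_mul τ
  · exact measurable_truncNormalCdf 0 τ measurable_const measurable_const measurable_id

/-- Let `v₁`, `v₂` be orthogonal contrasts of squared norm `2 α`, orthogonal to the mean `m`, such
that the constraints `A₁ y < b₁` do not involve `v₂` and the constraints `A₀ y ≤ b₀` do not involve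
`v₁`. Given the residual, the two inner products are then independent truncated normal
variables, so that their scores have the same law and the difference of their absolute values is
symmetric. -/
theorem pivotStat_symm {n : ℕ} {ι₁ ι₀ : Type*} [Finite ι₁] [Finite ι₀] {σ α : ℝ} (hσ : 0 < σ)
    (hα : 0 < α) (A₁ : Matrix ι₁ (Fin n) ℝ) (b₁ : ι₁ → ℝ) (A₀ : Matrix ι₀ (Fin n) ℝ) (b₀ : ι₀ → ℝ)
    {v₁ v₂ m : Fin n → ℝ} (h₁ : v₁ ⬝ᵥ v₁ = 2 * α) (h₂ : v₂ ⬝ᵥ v₂ = 2 * α) (h₁₂ : v₁ ⬝ᵥ v₂ = 0)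
    (hm₁ : v₁ ⬝ᵥ m = 0) (hm₂ : v₂ ⬝ᵥ m = 0) (hA₁ : A₁ *ᵥ v₂ = 0) (hA₀ : A₀ *ᵥ v₁ = 0) (t : ℝ) :
    (Measure.pi fun _ : Fin n => gaussianReal 0 (σ ^ 2).toNNReal)
      {ε | ((∀ i, (A₁ *ᵥ (m + ε)) i < b₁ i) ∧ ∀ i, (A₀ *ᵥ (m + ε)) i ≤ b₀ i) ∧
        pivotStat (σ * √(2 * α)) α A₁ b₁ A₀ b₀ v₁ v₂ (m + ε) ≤ -t} =
    (Measure.pi fun _ : Fin n => gaussianReal 0 (σ ^ 2).toNNReal)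
      {ε | ((∀ i, (A₁ *ᵥ (m + ε)) i < b₁ i) ∧ ∀ i, (A₀ *ᵥ (m + ε)) i ≤ b₀ i) ∧
        t ≤ pivotStat (σ * √(2 * α)) α A₁ b₁ A₀ b₀ v₁ v₂ (m + ε)} := by
  set τ := σ * √(2 * α) with hτdef
  have hκ : 0 < 2 * α := by positivity
  have hτ : 0 < τ := by positivity
  have hvar : (σ ^ 2).toNNReal * (2 * α).toNNReal = (τ ^ 2).toNNReal := by
    rw [← Real.toNNReal_mul (by positivity), hτdef, mul_pow, Real.sq_sqrt hκ.le]
  have hmap := map_resample_pi_gaussianReal (σ ^ 2).toNNReal hκ h₁ h₂ h₁₂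
  rw [hvar] at hmap
  set γ := Measure.pi fun _ : Fin n => gaussianReal 0 (σ ^ 2).toNNReal
  set N := gaussianReal 0 (τ ^ 2).toNNReal
  set Ψ : (Fin n → ℝ) × ℝ × ℝ → Fin n → ℝ := fun q =>
    q.1 - (2 * α)⁻¹ • ((v₁ ⬝ᵥ q.1) • v₁ + (v₂ ⬝ᵥ q.1) • v₂) +
      (2 * α)⁻¹ • (q.2.1 • v₁ + q.2.2 • v₂) with hΨ
  have hΨm : Measurable Ψ := by
    rw [hΨ]; unfold dotProduct; fun_prop
  have hstat : Measurable fun ε => pivotStat τ α A₁ b₁ A₀ b₀ v₁ v₂ (m + ε) :=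
    measurable_pivotStat τ α A₁ b₁ A₀ b₀ v₁ measurable_const (measurable_const_add m)
  have hcon : MeasurableSet {ε : Fin n → ℝ | (∀ i, (A₁ *ᵥ (m + ε)) i < b₁ i) ∧
      ∀ i, (A₀ *ᵥ (m + ε)) i ≤ b₀ i} :=
    (measurable_const_add m) (measurableSet_constraints A₁ b₁ A₀ b₀)
  have hS₁ := hcon.inter (measurableSet_le hstat (measurable_const (a := -t)))
  have hS₂ := hcon.inter (measurableSet_le (measurable_const (a := t)) hstat)
  -- resample the components along `v₁` and `v₂`, and fix the remaining component of the noise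
  rw [← hmap]
  refine ((Measure.map_apply hΨm hS₁).trans ?_).trans (Measure.map_apply hΨm hS₂).symm
  rw [Measure.prod_apply (hΨm hS₁), Measure.prod_apply (hΨm hS₂)]
  refine lintegral_congr fun ε => ?_
  set r : Fin n → ℝ := m + (ε - (2 * α)⁻¹ • ((v₁ ⬝ᵥ ε) • v₁ + (v₂ ⬝ᵥ ε) • v₂)) with hr
  have hv₁ : ∀ q : ℝ × ℝ, v₁ ⬝ᵥ (m + Ψ (ε, q)) = q.1 := by
    intro q
    simp only [hΨ, dotProduct_add, dotProduct_sub, dotProduct_smul, h₁, h₁₂, hm₁, smul_eq_mul]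
    field_simp
    ring
  have hv₂ : ∀ q : ℝ × ℝ, v₂ ⬝ᵥ (m + Ψ (ε, q)) = q.2 := by
    intro q
    simp only [hΨ, dotProduct_add, dotProduct_sub, dotProduct_smul, h₂, dotProduct_comm v₂ v₁, h₁₂,
      hm₂, smul_eq_mul]
    field_simp
    ring
  have hsplit : ∀ q : ℝ × ℝ, m + Ψ (ε, q) = r + (2 * α)⁻¹ • (q.1 • v₁ + q.2 • v₂) := by
    intro q
    simp only [hΨ, hr]
    abel
  have hres : ∀ q : ℝ × ℝ, pivotResidual α v₁ v₂ (m + Ψ (ε, q)) = r := by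
    intro q
    rw [pivotResidual, hv₁, hv₂, hsplit, add_sub_cancel_right]
  set a₁ := A₁ *ᵥ ((1 / 2 : ℝ) • v₁) with ha₁
  set a₀ := A₀ *ᵥ ((1 / 2 : ℝ) • v₂) with ha₀
  have hc₁ : ∀ (q : ℝ × ℝ) i, (A₁ *ᵥ (m + Ψ (ε, q))) i < b₁ i ↔
      a₁ i * q.1 < α * (b₁ i - (A₁ *ᵥ r) i) := by
    intro q i
    have : (A₁ *ᵥ (m + Ψ (ε, q))) i = (A₁ *ᵥ r) i + α⁻¹ * (a₁ i * q.1) := by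
      rw [hsplit, ha₁]
      simp only [mulVec_add, mulVec_smul, hA₁, Pi.add_apply, Pi.smul_apply, smul_eq_mul,
        Pi.zero_apply]
      field_simp
      ring
    rw [this, ← lt_sub_iff_add_lt', inv_mul_lt_iff₀ hα]
  have hc₀ : ∀ (q : ℝ × ℝ) i, (A₀ *ᵥ (m + Ψ (ε, q))) i ≤ b₀ i ↔
      a₀ i * q.2 ≤ α * (b₀ i - (A₀ *ᵥ r) i) := by
    intro q i
    have : (A₀ *ᵥ (m + Ψ (ε, q))) i = (A₀ *ᵥ r) i + α⁻¹ * (a₀ i * q.2) := by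
      rw [hsplit, ha₀]
      simp only [mulVec_add, mulVec_smul, hA₀, Pi.add_apply, Pi.smul_apply, smul_eq_mul,
        Pi.zero_apply]
      field_simp
      ring
    rw [this, ← le_sub_iff_add_le', inv_mul_le_iff₀ hα]
  have hval : ∀ q : ℝ × ℝ, pivotStat τ α A₁ b₁ A₀ b₀ v₁ v₂ (m + Ψ (ε, q)) =
      |truncScore τ α A₁ b₁ a₁ r q.1| - |truncScore τ α A₀ b₀ a₀ r q.2| := by
    intro q
    rw [pivotStat, hres, hv₁, hv₂]
  obtain ⟨k₁, hk₁⟩ := exists_map_truncNormalCdf_restrict_lt hτ a₁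
    fun i => α * (b₁ i - (A₁ *ᵥ r) i)
  obtain ⟨k₀, hk₀⟩ := exists_map_truncNormalCdf_restrict_le hτ a₀
    fun i => α * (b₀ i - (A₀ *ᵥ r) i)
  have := prod_rectangle_abs_sub_abs_symm
    (measurable_truncScore τ α A₁ b₁ measurable_const measurable_const measurable_id)
    (measurable_truncScore τ α A₀ b₀ measurable_const measurable_const measurable_id)
    (exists_map_truncScore A₁ b₁ a₁ r hk₁) (exists_map_truncScore A₀ b₀ a₀ r hk₀) t
  convert this using 2
  · ext q
    simp only [Set.mem_preimage, Set.mem_inter_iff, Set.mem_ofPred_eq, hc₁, hc₀, hval, id]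
  · ext q
    simp only [Set.mem_preimage, Set.mem_inter_iff, Set.mem_ofPred_eq, hc₁, hc₀, hval, id]

/-! ### Orthogonal projections -/

section Projection

variable {n : ℕ} {ι : Type*} [Fintype ι] [DecidableEq ι] {W : Matrix (Fin n) ι ℝ}

theorem isUnit_det_gram (hW : Function.Injective W.mulVec) : IsUnit (Wᵀ * W).det := by
  have := Matrix.PosDef.conjTranspose_mul_self W hW
  rw [conjTranspose_eq_transpose_of_trivial] at this
  exact this.det_pos.ne'.isUnit

theorem transpose_projMat (W : Matrix (Fin n) ι ℝ) : (projMat W)ᵀ = projMat W := by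
  simp only [projMat, transpose_mul, transpose_transpose, transpose_nonsing_inv, Matrix.mul_assoc]

theorem projMat_mul_self (hW : Function.Injective W.mulVec) : projMat W * W = W := by
  rw [projMat, Matrix.mul_assoc, Matrix.mul_assoc, Matrix.nonsing_inv_mul _ (isUnit_det_gram hW),
    Matrix.mul_one]

theorem projMat_mulVec_mulVec (hW : Function.Injective W.mulVec) (w : ι → ℝ) :
    projMat W *ᵥ (W *ᵥ w) = W *ᵥ w := by
  rw [mulVec_mulVec, projMat_mul_self hW]

theorem projMat_mulVec_eq_zero {v : Fin n → ℝ} (hv : Wᵀ *ᵥ v = 0) : projMat W *ᵥ v = 0 := by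
  rw [projMat, ← mulVec_mulVec, hv, mulVec_zero]

theorem transpose_mulVec_compl_projMat (hW : Function.Injective W.mulVec) (v : Fin n → ℝ) :
    Wᵀ *ᵥ ((1 - projMat W) *ᵥ v) = 0 := by
  have h : Wᵀ * projMat W = Wᵀ := by
    have := congrArg transpose (projMat_mul_self hW)
    rwa [transpose_mul, transpose_projMat] at this
  rw [mulVec_mulVec, Matrix.mul_sub, Matrix.mul_one, h, sub_self, zero_mulVec]

theorem dotProduct_compl_projMat_mulVec (W : Matrix (Fin n) ι ℝ) (v w : Fin n → ℝ) :
    v ⬝ᵥ ((1 - projMat W) *ᵥ w) = ((1 - projMat W) *ᵥ v) ⬝ᵥ w := by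
  rw [dotProduct_mulVec, ← mulVec_transpose, transpose_sub, transpose_one, transpose_projMat]

/-- A vector `W w` in the column space is recovered from its inner products with the columns by the
rows of the pseudoinverse `(WᵀW)⁻¹Wᵀ`. -/
theorem vecMul_pinv (hW : Function.Injective W.mulVec) (w : ι → ℝ) :
    (Wᵀ *ᵥ (W *ᵥ w)) ᵥ* ((Wᵀ * W)⁻¹ * Wᵀ) = W *ᵥ w := by
  rw [mulVec_mulVec, ← vecMul_transpose, vecMul_vecMul, transpose_mul, transpose_transpose,
    ← Matrix.mul_assoc, Matrix.mul_nonsing_inv _ (isUnit_det_gram hW), Matrix.one_mul,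
    vecMul_transpose]

end Projection

/-! ### Columns of the design -/

section Columns

variable {n p : ℕ} {X : Matrix (Fin n) (Fin p) ℝ} {S : Finset (Fin p)}

/-- The columns of `X` with index in `S` are linearly independent. -/
def HasIndepCols (X : Matrix (Fin n) (Fin p) ℝ) (S : Finset (Fin p)) : Prop :=
  ∀ w : Fin p → ℝ, (∀ k ∉ S, w k = 0) → X *ᵥ w = 0 → w = 0

theorem HasIndepCols.mono {T : Finset (Fin p)} (h : HasIndepCols X S) (hT : T ⊆ S) :
    HasIndepCols X T := fun w hw => h w fun k hk => hw k fun hk' => hk (hT hk')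

/-- Extension by zero of a vector of coefficients on `S`. -/
def extendZero (S : Finset (Fin p)) (c : {k // k ∈ S} → ℝ) : Fin p → ℝ :=
  fun k => if h : k ∈ S then c ⟨k, h⟩ else 0

theorem extendZero_of_notMem (c : {k // k ∈ S} → ℝ) {k : Fin p} (hk : k ∉ S) :
    extendZero S c k = 0 := dif_neg hk

theorem extendZero_coe (c : {k // k ∈ S} → ℝ) (k : {k // k ∈ S}) :
    extendZero S c k = c k := dif_pos k.2

theorem colSub_mulVec_restrict (X : Matrix (Fin n) (Fin p) ℝ) {w : Fin p → ℝ}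
    (hw : ∀ k ∉ S, w k = 0) : colSub X S *ᵥ (fun k => w k) = X *ᵥ w := by
  ext i
  simp only [mulVec, dotProduct, colSub, submatrix_apply, id]
  rw [Finset.sum_coe_sort S (fun k => X i k * w k)]
  exact Finset.sum_subset (Finset.subset_univ S) fun k _ hk => by rw [hw k hk, mul_zero]

theorem colSub_mulVec (X : Matrix (Fin n) (Fin p) ℝ) (c : {k // k ∈ S} → ℝ) :
    colSub X S *ᵥ c = X *ᵥ extendZero S c := by
  rw [← colSub_mulVec_restrict (S := S) X fun k hk => extendZero_of_notMem c hk]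
  congr 1
  ext k
  rw [extendZero_coe]

theorem HasIndepCols.injective (h : HasIndepCols X S) :
    Function.Injective (colSub X S).mulVec := by
  intro c d hcd
  have h0 : colSub X S *ᵥ (c - d) = 0 := by rw [mulVec_sub, sub_eq_zero]; exact hcd
  rw [colSub_mulVec] at h0
  have h1 := h _ (fun k hk => extendZero_of_notMem _ hk) h0
  ext k
  have h2 := congrFun h1 k
  rw [extendZero_coe] at h2
  simpa [sub_eq_zero] using h2

theorem compl_projMat_colSub_mulVec_mulVec (h : HasIndepCols X S) {w : Fin p → ℝ}
    (hw : ∀ k ∉ S, w k = 0) : (1 - projMat (colSub X S)) *ᵥ (X *ᵥ w) = 0 := by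
  rw [← colSub_mulVec_restrict X hw, sub_mulVec, one_mulVec, projMat_mulVec_mulVec h.injective,
    sub_self]

theorem mulVec_dotProduct_eq_zero {w : Fin p → ℝ} (hw : ∀ k ∉ S, w k = 0) {v : Fin n → ℝ}
    (hv : (colSub X S)ᵀ *ᵥ v = 0) : v ⬝ᵥ (X *ᵥ w) = 0 := by
  rw [← colSub_mulVec_restrict X hw, dotProduct_mulVec, ← mulVec_transpose, hv, zero_dotProduct]

theorem col_eq_mulVec_single (X : Matrix (Fin n) (Fin p) ℝ) (j : Fin p) :
    X.col j = X *ᵥ Pi.single j 1 := by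
  simp

end Columns

/-! ### The contrasts of the mirror design -/

section Mirror

variable {n p : ℕ} {X : Matrix (Fin n) (Fin p) ℝ} {S : Finset (Fin p)} {j : Fin p}

/-- The component of `x_j` orthogonal to the other columns with index in `S`. -/
noncomputable def colResidual (X : Matrix (Fin n) (Fin p) ℝ) (S : Finset (Fin p)) (j : Fin p) :
    Fin n → ℝ :=
  (1 - projMat (colSub X (S.erase j))) *ᵥ X.col j

/-- The sum `ψ₁ + ψ₂` (for `z̃ ≠ 0`): the functional that gives the coefficient of `x_j` in the least
squares regression on `X_S`. -/
noncomputable def sumContrast (X : Matrix (Fin n) (Fin p) ℝ) (S : Finset (Fin p)) (j : Fin p) :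
    Fin n → ℝ :=
  (colResidual X S j ⬝ᵥ colResidual X S j)⁻¹ • colResidual X S j

/-- The difference `ψ₁ - ψ₂` (for `z̃ ≠ 0`): a multiple of `z̃` of the same norm as `ψ₁ + ψ₂`. -/
noncomputable def diffContrast (X : Matrix (Fin n) (Fin p) ℝ) (S : Finset (Fin p)) (j : Fin p)
    (z : Fin n → ℝ) : Fin n → ℝ :=
  (√(colResidual X S j ⬝ᵥ colResidual X S j) * √(zTilde X S z ⬝ᵥ zTilde X S z))⁻¹ •
    zTilde X S z

/-- The squared norm of `ψ₁`, which does not depend on `z`. -/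
noncomputable def contrastAlpha (X : Matrix (Fin n) (Fin p) ℝ) (S : Finset (Fin p)) (j : Fin p) :
    ℝ :=
  (2 * (colResidual X S j ⬝ᵥ colResidual X S j))⁻¹

theorem exists_colResidual_eq (X : Matrix (Fin n) (Fin p) ℝ) (S : Finset (Fin p)) (j : Fin p) :
    ∃ c : {k // k ∈ S.erase j} → ℝ, colResidual X S j = X.col j - colSub X (S.erase j) *ᵥ c := by
  refine ⟨((colSub X (S.erase j))ᵀ * colSub X (S.erase j))⁻¹ *ᵥ
    ((colSub X (S.erase j))ᵀ *ᵥ X.col j), ?_⟩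
  rw [colResidual, sub_mulVec, one_mulVec, projMat, mulVec_mulVec, mulVec_mulVec]

theorem exists_colResidual_eq_mulVec (X : Matrix (Fin n) (Fin p) ℝ) (S : Finset (Fin p))
    (j : Fin p) :
    ∃ w : Fin p → ℝ, colResidual X S j = X *ᵥ w ∧ w j = 1 ∧ ∀ k ∉ S, k ≠ j → w k = 0 := by
  obtain ⟨c, hc⟩ := exists_colResidual_eq X S j
  refine ⟨Pi.single j 1 - extendZero (S.erase j) c, ?_, ?_, fun k hk hkj => ?_⟩
  · rw [hc, mulVec_sub, colSub_mulVec, col_eq_mulVec_single]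
  · simp [extendZero]
  · have : k ∉ S.erase j := fun h => hk (Finset.mem_of_mem_erase h)
    simp [extendZero_of_notMem c this, hkj]

theorem colResidual_ne_zero (h : HasIndepCols X S) (hj : j ∈ S) : colResidual X S j ≠ 0 := by
  obtain ⟨w, hw, hwj, hw0⟩ := exists_colResidual_eq_mulVec X S j
  intro h0
  have := h w (fun k hk => hw0 k hk fun e => hk (e ▸ hj)) (hw ▸ h0)
  rw [this] at hwj
  simp at hwj

theorem dotProduct_self_pos {v : Fin n → ℝ} (hv : v ≠ 0) : 0 < v ⬝ᵥ v :=
  lt_of_le_of_ne (dotProduct_self_star_nonneg v) fun h => hv (dotProduct_self_eq_zero.1 h.symm)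

theorem transpose_colSub_mulVec_zTilde (h : HasIndepCols X S) (z : Fin n → ℝ) :
    (colSub X S)ᵀ *ᵥ zTilde X S z = 0 :=
  transpose_mulVec_compl_projMat h.injective z

theorem zTilde_dotProduct_mulVec (h : HasIndepCols X S) (z : Fin n → ℝ) {w : Fin p → ℝ}
    (hw : ∀ k ∉ S, w k = 0) : zTilde X S z ⬝ᵥ (X *ᵥ w) = 0 :=
  mulVec_dotProduct_eq_zero hw (transpose_colSub_mulVec_zTilde h z)

theorem zTilde_dotProduct_col (h : HasIndepCols X S) (z : Fin n → ℝ) {k : Fin p} (hk : k ∈ S) :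
    zTilde X S z ⬝ᵥ X.col k = 0 := by
  rw [col_eq_mulVec_single]
  refine zTilde_dotProduct_mulVec h z fun i hi => ?_
  rw [Pi.single_eq_of_ne]
  rintro rfl
  exact hi hk

theorem colResidual_dotProduct_mulVec (h : HasIndepCols X S) {w : Fin p → ℝ}
    (hw : ∀ k ∉ S.erase j, w k = 0) : colResidual X S j ⬝ᵥ (X *ᵥ w) = 0 :=
  mulVec_dotProduct_eq_zero hw
    (transpose_mulVec_compl_projMat (h.mono (Finset.erase_subset j S)).injective _)

theorem colResidual_dotProduct_col_of_mem (h : HasIndepCols X S) {k : Fin p}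
    (hk : k ∈ S.erase j) : colResidual X S j ⬝ᵥ X.col k = 0 := by
  rw [col_eq_mulVec_single]
  refine colResidual_dotProduct_mulVec h fun i hi => ?_
  rw [Pi.single_eq_of_ne]
  rintro rfl
  exact hi hk

theorem colResidual_dotProduct_col_self (h : HasIndepCols X S) :
    colResidual X S j ⬝ᵥ X.col j = colResidual X S j ⬝ᵥ colResidual X S j := by
  obtain ⟨c, hc⟩ := exists_colResidual_eq X S j
  conv_rhs => rw [hc]
  rw [dotProduct_sub, ← hc, colSub_mulVec, colResidual_dotProduct_mulVec h fun k hk =>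
    extendZero_of_notMem c hk, sub_zero]

theorem zTilde_dotProduct_colResidual (h : HasIndepCols X S) (hj : j ∈ S) (z : Fin n → ℝ) :
    zTilde X S z ⬝ᵥ colResidual X S j = 0 := by
  obtain ⟨w, hw, -, hw0⟩ := exists_colResidual_eq_mulVec X S j
  rw [hw]
  exact zTilde_dotProduct_mulVec h z fun k hk => hw0 k hk fun e => hk (e ▸ hj)

theorem mirrorScale_eq (h : HasIndepCols X S) (z : Fin n → ℝ) :
    mirrorScale X S j z =
      √(colResidual X S j ⬝ᵥ colResidual X S j) / √(zTilde X S z ⬝ᵥ zTilde X S z) := by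
  have h1 : (colSub X (S.erase j))ᵀ *ᵥ zTilde X S z = 0 := by
    ext k
    have := zTilde_dotProduct_col h z (Finset.mem_of_mem_erase k.2)
    rw [dotProduct_comm] at this
    exact this
  have h2 : X.col j ⬝ᵥ ((1 - projMat (colSub X (S.erase j))) *ᵥ X.col j) =
      colResidual X S j ⬝ᵥ colResidual X S j := by
    rw [← colResidual_dotProduct_col_self h, dotProduct_comm, colResidual]
  rw [mirrorScale, h2, sub_mulVec _ _ (zTilde X S z), one_mulVec, projMat_mulVec_eq_zero h1,
    sub_zero, Real.sqrt_div (by simpa using dotProduct_self_star_nonneg (colResidual X S j))]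

theorem mirrorDesign_mulVec (X : Matrix (Fin n) (Fin p) ℝ) (S : Finset (Fin p)) (j : Fin p)
    (z : Fin n → ℝ) (w : Fin 2 ⊕ {k // k ∈ S.erase j} → ℝ) :
    mirrorDesign X S j z *ᵥ w =
      w (Sum.inl 0) • (X.col j + mirrorScale X S j z • zTilde X S z) +
      w (Sum.inl 1) • (X.col j - mirrorScale X S j z • zTilde X S z) +
      colSub X (S.erase j) *ᵥ fun k => w (Sum.inr k) := by
  ext i
  simp [mulVec, dotProduct, mirrorDesign, Fintype.sum_sum_type, colSub]
  ring

theorem transpose_mirrorDesign_mulVec (X : Matrix (Fin n) (Fin p) ℝ) (S : Finset (Fin p))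
    (j : Fin p) (z v : Fin n → ℝ) :
    (mirrorDesign X S j z)ᵀ *ᵥ v = Sum.elim
      ![v ⬝ᵥ X.col j + mirrorScale X S j z * (v ⬝ᵥ zTilde X S z),
        v ⬝ᵥ X.col j - mirrorScale X S j z * (v ⬝ᵥ zTilde X S z)]
      (fun k : {k // k ∈ S.erase j} => v ⬝ᵥ X.col k.1) := by
  ext (l | k)
  · fin_cases l <;>
    simp [mulVec, dotProduct, mirrorDesign, Finset.mul_sum, ← Finset.sum_add_distrib,
      ← Finset.sum_sub_distrib] <;>
    exact Finset.sum_congr rfl fun i _ => by ring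
  · simp [mulVec, dotProduct, mirrorDesign, mul_comm]

theorem diffContrast_eq (h : HasIndepCols X S) {z : Fin n → ℝ} (hz : zTilde X S z ≠ 0) :
    diffContrast X S j z =
      (mirrorScale X S j z * (zTilde X S z ⬝ᵥ zTilde X S z))⁻¹ • zTilde X S z := by
  have hq := dotProduct_self_pos hz
  have hq' := Real.sqrt_pos.2 hq
  have e : √(zTilde X S z ⬝ᵥ zTilde X S z) ^ 2 = zTilde X S z ⬝ᵥ zTilde X S z :=
    Real.sq_sqrt hq.le
  rw [diffContrast, mirrorScale_eq h]
  congr 2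
  conv_rhs => rw [← e]
  field_simp
  rw [Real.sqrt_sq hq'.le]

theorem mirrorScale_pos (h : HasIndepCols X S) (hj : j ∈ S) {z : Fin n → ℝ}
    (hz : zTilde X S z ≠ 0) : 0 < mirrorScale X S j z := by
  rw [mirrorScale_eq h]
  exact div_pos (Real.sqrt_pos.2 (dotProduct_self_pos (colResidual_ne_zero h hj)))
    (Real.sqrt_pos.2 (dotProduct_self_pos hz))

/-- `ψ₁ + ψ₂` is dual to the first two columns of the mirror design and orthogonal to the others. -/
theorem transpose_mirrorDesign_mulVec_sumContrast (h : HasIndepCols X S) (hj : j ∈ S)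
    (z : Fin n → ℝ) :
    (mirrorDesign X S j z)ᵀ *ᵥ sumContrast X S j = Sum.elim ![1, 1] 0 := by
  have hu := dotProduct_self_pos (colResidual_ne_zero h hj)
  rw [transpose_mirrorDesign_mulVec]
  simp only [sumContrast, smul_dotProduct, colResidual_dotProduct_col_self h,
    dotProduct_comm (colResidual X S j) (zTilde X S z), zTilde_dotProduct_colResidual h hj,
    smul_eq_mul, mul_zero,
    add_zero, sub_zero, inv_mul_cancel₀ hu.ne']
  congr 1
  ext k
  rw [colResidual_dotProduct_col_of_mem h k.2, mul_zero, Pi.zero_apply]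

theorem transpose_mirrorDesign_mulVec_diffContrast (h : HasIndepCols X S) (hj : j ∈ S)
    {z : Fin n → ℝ} (hz : zTilde X S z ≠ 0) :
    (mirrorDesign X S j z)ᵀ *ᵥ diffContrast X S j z = Sum.elim ![1, -1] 0 := by
  have hc := mirrorScale_pos h hj hz
  have hq := dotProduct_self_pos hz
  rw [transpose_mirrorDesign_mulVec, diffContrast_eq h hz]
  simp only [smul_dotProduct, zTilde_dotProduct_col h z hj, smul_eq_mul, mul_zero, zero_add,
    zero_sub]
  have e : mirrorScale X S j z * ((mirrorScale X S j z * (zTilde X S z ⬝ᵥ zTilde X S z))⁻¹ *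
      (zTilde X S z ⬝ᵥ zTilde X S z)) = 1 := by field_simp
  rw [e]
  congr 1
  ext k
  rw [zTilde_dotProduct_col h z (Finset.mem_of_mem_erase k.2), mul_zero, Pi.zero_apply]

theorem injective_mirrorDesign (h : HasIndepCols X S) (hj : j ∈ S)
    {z : Fin n → ℝ} (hz : zTilde X S z ≠ 0) :
    Function.Injective (mirrorDesign X S j z).mulVec := by
  intro w w' hww
  have h0 : mirrorDesign X S j z *ᵥ (w - w') = 0 := by rw [mulVec_sub, sub_eq_zero]; exact hww
  rw [← sub_eq_zero]
  generalize w - w' = d at h0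
  -- pairing with the two contrasts isolates the first two coefficients
  have h1 : d (Sum.inl 0) + d (Sum.inl 1) = 0 := by
    have := congrArg (sumContrast X S j ⬝ᵥ ·) h0
    simp only [dotProduct_mulVec, ← mulVec_transpose,
      transpose_mirrorDesign_mulVec_sumContrast h hj, dotProduct_zero] at this
    simpa [dotProduct, Fintype.sum_sum_type] using this
  have h2 : d (Sum.inl 0) - d (Sum.inl 1) = 0 := by
    have := congrArg (diffContrast X S j z ⬝ᵥ ·) h0
    simp only [dotProduct_mulVec, ← mulVec_transpose,
      transpose_mirrorDesign_mulVec_diffContrast h hj hz, dotProduct_zero] at this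
    simpa [dotProduct, Fintype.sum_sum_type, sub_eq_add_neg] using this
  have h3 : d (Sum.inl 0) = 0 := by linarith
  have h4 : d (Sum.inl 1) = 0 := by linarith
  rw [mirrorDesign_mulVec, h3, h4, zero_smul, zero_smul, zero_add, zero_add] at h0
  have h5 : (fun k => d (Sum.inr k)) = 0 :=
    (h.mono (Finset.erase_subset j S)).injective (by simpa using h0)
  ext (l | k)
  · fin_cases l
    · exact h3
    · exact h4
  · exact congrFun h5 k

theorem mirrorPsi_add (h : HasIndepCols X S) (hj : j ∈ S) {z : Fin n → ℝ}
    (hz : zTilde X S z ≠ 0) :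
    mirrorPsi X S j z 0 + mirrorPsi X S j z 1 = sumContrast X S j := by
  obtain ⟨c, hc⟩ := exists_colResidual_eq X S j
  set κ := colResidual X S j ⬝ᵥ colResidual X S j with hκ
  have hw : sumContrast X S j =
      mirrorDesign X S j z *ᵥ (κ⁻¹ • Sum.elim ![1 / 2, 1 / 2] (-c)) := by
    rw [mulVec_smul, mirrorDesign_mulVec, sumContrast, ← hκ, hc]
    congr 1
    have : (fun k => Sum.elim ![1 / 2, 1 / 2] (-c) (Sum.inr k)) = -c := rfl
    rw [this, mulVec_neg]
    ext i
    simp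
    ring
  have := vecMul_pinv (injective_mirrorDesign h hj hz) (κ⁻¹ • Sum.elim ![1 / 2, 1 / 2] (-c))
  rw [← hw, transpose_mirrorDesign_mulVec_sumContrast h hj] at this
  rw [← this]
  ext i
  simp [vecMul, dotProduct, Fintype.sum_sum_type, mirrorPsi]

theorem mirrorPsi_sub (h : HasIndepCols X S) (hj : j ∈ S) {z : Fin n → ℝ}
    (hz : zTilde X S z ≠ 0) :
    mirrorPsi X S j z 0 - mirrorPsi X S j z 1 = diffContrast X S j z := by
  have hc := mirrorScale_pos h hj hz
  set κ := mirrorScale X S j z * (zTilde X S z ⬝ᵥ zTilde X S z) with hκ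
  have hw : diffContrast X S j z = mirrorDesign X S j z *ᵥ
      ((κ⁻¹ * (2 * mirrorScale X S j z)⁻¹) • Sum.elim ![1, -1] 0) := by
    rw [mulVec_smul, mirrorDesign_mulVec, diffContrast_eq h hz, ← hκ, mul_smul]
    congr 1
    have : (fun k => Sum.elim ![(1 : ℝ), -1] (0 : {k // k ∈ S.erase j} → ℝ) (Sum.inr k)) = 0 := rfl
    rw [this, mulVec_zero]
    ext i
    simp
    field_simp
    ring
  have := vecMul_pinv (injective_mirrorDesign h hj hz)
    ((κ⁻¹ * (2 * mirrorScale X S j z)⁻¹) • Sum.elim ![1, -1] 0)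
  rw [← hw, transpose_mirrorDesign_mulVec_diffContrast h hj hz] at this
  rw [← this]
  ext i
  simp [vecMul, dotProduct, Fintype.sum_sum_type, mirrorPsi, sub_eq_add_neg]

theorem contrastAlpha_pos (h : HasIndepCols X S) (hj : j ∈ S) : 0 < contrastAlpha X S j := by
  have := dotProduct_self_pos (colResidual_ne_zero h hj)
  unfold contrastAlpha
  positivity

theorem sumContrast_dotProduct_self (h : HasIndepCols X S) (hj : j ∈ S) :
    sumContrast X S j ⬝ᵥ sumContrast X S j = 2 * contrastAlpha X S j := by
  have := dotProduct_self_pos (colResidual_ne_zero h hj)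
  simp only [sumContrast, contrastAlpha, smul_dotProduct, dotProduct_smul, smul_eq_mul]
  field_simp

theorem diffContrast_dotProduct_self (h : HasIndepCols X S) (hj : j ∈ S) {z : Fin n → ℝ}
    (hz : zTilde X S z ≠ 0) :
    diffContrast X S j z ⬝ᵥ diffContrast X S j z = 2 * contrastAlpha X S j := by
  have h1 := dotProduct_self_pos (colResidual_ne_zero h hj)
  have h2 := dotProduct_self_pos hz
  simp only [diffContrast, contrastAlpha, smul_dotProduct, dotProduct_smul, smul_eq_mul]
  rw [← mul_assoc, ← mul_inv, mul_mul_mul_comm, Real.mul_self_sqrt h1.le, Real.mul_self_sqrt h2.le]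
  field_simp

theorem sumContrast_dotProduct_diffContrast (h : HasIndepCols X S) (hj : j ∈ S) (z : Fin n → ℝ) :
    sumContrast X S j ⬝ᵥ diffContrast X S j z = 0 := by
  rw [sumContrast, diffContrast, smul_dotProduct, dotProduct_smul,
    dotProduct_comm (colResidual X S j) (zTilde X S z), zTilde_dotProduct_colResidual h hj,
    smul_zero, smul_zero]

theorem sumContrast_dotProduct_mulVec (h : HasIndepCols X S) {w : Fin p → ℝ}
    (hw : ∀ k ∉ S.erase j, w k = 0) : sumContrast X S j ⬝ᵥ (X *ᵥ w) = 0 := by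
  rw [sumContrast, smul_dotProduct, colResidual_dotProduct_mulVec h hw, smul_zero]

theorem diffContrast_dotProduct_mulVec (h : HasIndepCols X S) (z : Fin n → ℝ) {w : Fin p → ℝ}
    (hw : ∀ k ∉ S, w k = 0) : diffContrast X S j z ⬝ᵥ (X *ᵥ w) = 0 := by
  rw [diffContrast, smul_dotProduct, zTilde_dotProduct_mulVec h z hw, smul_zero]

theorem activeMat_mulVec_diffContrast (h : HasIndepCols X S) (s : {k // k ∈ S} → ℝ)
    (z : Fin n → ℝ) : activeMat X S s *ᵥ diffContrast X S j z = 0 := by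
  rw [activeMat, diffContrast, mulVec_smul, neg_mulVec, ← mulVec_mulVec,
    transpose_colSub_mulVec_zTilde h, mulVec_zero, neg_zero, smul_zero]

theorem inactiveMat_mulVec_sumContrast (h : HasIndepCols X S) (hj : j ∈ S) (lam : ℝ) :
    inactiveMat X lam S *ᵥ sumContrast X S j = 0 := by
  obtain ⟨w, hw, -, hw0⟩ := exists_colResidual_eq_mulVec X S j
  have h0 : ((colCompl X S)ᵀ * (1 - projMat (colSub X S))) *ᵥ colResidual X S j = 0 := by
    rw [← mulVec_mulVec, hw, compl_projMat_colSub_mulVec_mulVec h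
      (fun k hk => hw0 k hk fun e => hk (e ▸ hj)), mulVec_zero]
  rw [inactiveMat, sumContrast, mulVec_smul, smul_mulVec, fromRows_mulVec, neg_mulVec, h0, neg_zero]
  ext (k | k) <;> simp

theorem mirrorPsi_eq (h : HasIndepCols X S) (hj : j ∈ S) {z : Fin n → ℝ}
    (hz : zTilde X S z ≠ 0) :
    mirrorPsi X S j z 0 = (1 / 2 : ℝ) • (sumContrast X S j + diffContrast X S j z) ∧
      mirrorPsi X S j z 1 = (1 / 2 : ℝ) • (sumContrast X S j - diffContrast X S j z) := by
  rw [← mirrorPsi_add h hj hz, ← mirrorPsi_sub h hj hz]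
  constructor <;> (ext i; simp; ring)

theorem mirrorAlpha_eq (h : HasIndepCols X S) (hj : j ∈ S) {z : Fin n → ℝ}
    (hz : zTilde X S z ≠ 0) : mirrorAlpha X S j z = contrastAlpha X S j := by
  rw [mirrorAlpha, (mirrorPsi_eq h hj hz).1]
  simp only [smul_dotProduct, dotProduct_smul, add_dotProduct, dotProduct_add,
    sumContrast_dotProduct_self h hj, diffContrast_dotProduct_self h hj hz,
    dotProduct_comm (diffContrast X S j z), sumContrast_dotProduct_diffContrast h hj, smul_eq_mul]
  ring

theorem mirrorResidual_eq (h : HasIndepCols X S) (hj : j ∈ S) {z : Fin n → ℝ}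
    (hz : zTilde X S z ≠ 0) (y : Fin n → ℝ) :
    mirrorResidual X S j z y = pivotResidual (contrastAlpha X S j) (sumContrast X S j)
      (diffContrast X S j z) y := by
  have hα := contrastAlpha_pos h hj
  obtain ⟨h0, h1⟩ := mirrorPsi_eq h hj hz
  set α := contrastAlpha X S j
  set Q : Matrix (Fin n) (Fin 2) ℝ := Matrix.of fun i l => mirrorPsi X S j z l i with hQ
  have hgram : Qᵀ * Q = α • (1 : Matrix (Fin 2) (Fin 2) ℝ) := by
    ext a b
    have : (Qᵀ * Q) a b = mirrorPsi X S j z a ⬝ᵥ mirrorPsi X S j z b := rfl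
    rw [this]
    fin_cases a <;> fin_cases b <;>
    simp [h0, h1, smul_dotProduct, dotProduct_smul, add_dotProduct, dotProduct_add,
      sub_dotProduct, dotProduct_sub,
      sumContrast_dotProduct_self h hj, diffContrast_dotProduct_self h hj hz,
      dotProduct_comm (diffContrast X S j z), sumContrast_dotProduct_diffContrast h hj] <;>
    ring
  have hinv : (α • (1 : Matrix (Fin 2) (Fin 2) ℝ))⁻¹ = α⁻¹ • 1 := by
    refine Matrix.inv_eq_right_inv ?_
    rw [smul_mul_smul_comm, mul_inv_cancel₀ hα.ne', Matrix.mul_one, one_smul]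
  rw [mirrorResidual, pivotResidual, sub_mulVec, one_mulVec, ← hQ, projMat, hgram, hinv]
  congr 1
  rw [Matrix.mul_smul, Matrix.mul_one, Matrix.smul_mul, smul_mulVec, ← mulVec_mulVec, mul_inv,
    mul_comm, mul_smul]
  congr 1
  have hy : Qᵀ *ᵥ y = fun l => mirrorPsi X S j z l ⬝ᵥ y := rfl
  ext i
  have hQv : ∀ g : Fin 2 → ℝ,
      (Q *ᵥ g) i = mirrorPsi X S j z 0 i * g 0 + mirrorPsi X S j z 1 i * g 1 := fun g => by
    simp [mulVec, dotProduct, Fin.sum_univ_two, hQ]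
  rw [hy, hQv]
  simp only [h0, h1, smul_dotProduct, add_dotProduct, sub_dotProduct, Pi.smul_apply,
    Pi.add_apply, Pi.sub_apply, smul_eq_mul]
  ring

/-- In terms of the contrasts, the mirror statistic is a pivotal statistic whose scale does not
depend on the simulated vector. -/
theorem mirrorStat_eq_pivotStat (h : HasIndepCols X S) (hj : j ∈ S) {z : Fin n → ℝ}
    (hz : zTilde X S z ≠ 0) (lam σ : ℝ) (s : {k // k ∈ S} → ℝ) (y : Fin n → ℝ) :
    mirrorStat X lam σ S s j z y =
      pivotStat (σ * √(2 * contrastAlpha X S j)) (contrastAlpha X S j) (activeMat X S s)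
        (activeBound X lam S s) (inactiveMat X lam S) (inactiveBound X S s) (sumContrast X S j)
        (diffContrast X S j z) y := by
  have h1 : betaPlus X S j z y + betaMinus X S j z y = sumContrast X S j ⬝ᵥ y := by
    rw [betaPlus, betaMinus, ← add_dotProduct, mirrorPsi_add h hj hz]
  have h2 : betaPlus X S j z y - betaMinus X S j z y = diffContrast X S j z ⬝ᵥ y := by
    rw [betaPlus, betaMinus, ← sub_dotProduct, mirrorPsi_sub h hj hz]
  rw [mirrorStat, h1, h2, mirrorSd, activeDir, inactiveDir, mirrorPsi_add h hj hz,
    mirrorPsi_sub h hj hz, mirrorAlpha_eq h hj hz, mirrorResidual_eq h hj hz]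
  rfl

theorem measurable_diffContrast (X : Matrix (Fin n) (Fin p) ℝ) (S : Finset (Fin p)) (j : Fin p) :
    Measurable (diffContrast X S j) := by
  have hz : Measurable (zTilde X S) :=
    measurable_pi_iff.2 fun i => measurable_mulVec_apply _ measurable_id i
  unfold diffContrast
  exact ((measurable_const.mul (measurable_dotProduct hz hz).sqrt).inv).smul hz

end Mirror

/-! ### The lasso and its selection events -/

section Lasso

variable {n p : ℕ} {X : Matrix (Fin n) (Fin p) ℝ} {lam : ℝ} {y : Fin n → ℝ} {b : Fin p → ℝ}

theorem abs_eq_sign_mul (x : ℝ) : |x| = Real.sign x * x := by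
  rcases lt_trichotomy x 0 with h | h | h
  · rw [Real.sign_of_neg h, abs_of_neg h]; ring
  · simp [h]
  · rw [Real.sign_of_pos h, abs_of_pos h]; ring

/-- The exact second-order expansion of the lasso objective around `b`. -/
theorem lassoObjective_add (X : Matrix (Fin n) (Fin p) ℝ) (lam : ℝ) (y : Fin n → ℝ)
    (b h : Fin p → ℝ) :
    lassoObjective X lam y (b + h) = lassoObjective X lam y b + (X *ᵥ h) ⬝ᵥ (X *ᵥ h) +
      ∑ k, (lam * (|b k + h k| - |b k|) - 2 * (X.col k ⬝ᵥ (y - X *ᵥ b)) * h k) := by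
  have e : (X *ᵥ h) ⬝ᵥ (y - X *ᵥ b) = ∑ k, (X.col k ⬝ᵥ (y - X *ᵥ b)) * h k := by
    rw [dotProduct_comm, dotProduct_mulVec, ← mulVec_transpose]
    rfl
  have e2 : y - X *ᵥ (b + h) = (y - X *ᵥ b) - X *ᵥ h := by rw [mulVec_add]; abel
  simp only [lassoObjective]
  rw [e2, sub_dotProduct (y - X *ᵥ b), dotProduct_sub (y - X *ᵥ b), dotProduct_sub (X *ᵥ h),
    dotProduct_comm (y - X *ᵥ b) (X *ᵥ h), e]
  simp only [Finset.sum_sub_distrib, mul_assoc, ← Finset.mul_sum, Pi.add_apply]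
  ring

/-- A function `c h² + d h` that is nonnegative near `0` has zero slope there. -/
theorem eq_zero_of_forall_quadratic_nonneg {c d δ : ℝ} (hδ : 0 < δ)
    (h : ∀ x, |x| < δ → 0 ≤ c * x ^ 2 + d * x) : d = 0 := by
  have hle : ∀ d' : ℝ, (∀ x, |x| < δ → 0 ≤ c * x ^ 2 + d' * x) → 0 ≤ d' := by
    intro d' h'
    by_contra! hd
    set x := min (δ / 2) (-d' / (2 * (|c| + 1))) with hx
    have hc : 0 < 2 * (|c| + 1) := by positivity
    have hx0 : 0 < x := lt_min (by positivity) (div_pos (by linarith) hc)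
    have hx1 : x < δ := (min_le_left _ _).trans_lt (by linarith)
    have hx2 : x * (2 * (|c| + 1)) ≤ -d' := (le_div_iff₀ hc).1 (min_le_right _ _)
    have := h' x (by rwa [abs_of_pos hx0])
    have h3 : 0 ≤ c * x + d' := by
      have : 0 ≤ x * (c * x + d') := by nlinarith
      exact nonneg_of_mul_nonneg_right this hx0
    nlinarith [le_abs_self c, abs_nonneg c]
  refine le_antisymm ?_ (hle d h)
  have := hle (-d) fun x hx => by
    have := h (-x) (by rwa [abs_neg])
    nlinarith
  linarith

/-- If `c x² + l |x| - d x` is nonnegative for all `x`, the kink at `0` dominates the slope. -/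
theorem le_of_forall_quadratic_nonneg {c d l : ℝ}
    (h : ∀ x : ℝ, 0 ≤ c * x ^ 2 + l * |x| - d * x) : |d| ≤ l := by
  have key : ∀ d' : ℝ, (∀ x : ℝ, 0 < x → 0 ≤ c * x ^ 2 + l * x - d' * x) → d' ≤ l := by
    intro d' h'
    by_contra! hd
    have hc : 0 < 2 * (|c| + 1) := by positivity
    set x := (d' - l) / (2 * (|c| + 1)) with hx
    have hx0 : 0 < x := div_pos (by linarith) hc
    have hx2 : x * (2 * (|c| + 1)) = d' - l := div_mul_cancel₀ _ hc.ne'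
    have h3 : 0 ≤ c * x + l - d' := by
      have : 0 ≤ x * (c * x + l - d') := by nlinarith [h' x hx0]
      exact nonneg_of_mul_nonneg_right this hx0
    nlinarith [le_abs_self c, abs_nonneg c]
  refine abs_le.2 ⟨?_, key d fun x hx => by simpa [abs_of_pos hx] using h x⟩
  have := key (-d) fun x hx => by
    have := h (-x)
    rw [abs_neg, abs_of_pos hx] at this
    nlinarith
  linarith

/-- The Karush-Kuhn-Tucker conditions of the lasso. -/
theorem isLassoSolution_iff (hlam : 0 < lam) :
    IsLassoSolution X lam y b ↔ ∀ k, |X.col k ⬝ᵥ (y - X *ᵥ b)| ≤ lam / 2 ∧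
      (b k ≠ 0 → X.col k ⬝ᵥ (y - X *ᵥ b) = lam / 2 * Real.sign (b k)) := by
  constructor
  · intro hb k
    set g := X.col k ⬝ᵥ (y - X *ᵥ b) with hg
    set c := (X *ᵥ Pi.single k 1) ⬝ᵥ (X *ᵥ Pi.single k 1) with hc
    have hdir : ∀ x : ℝ, 0 ≤ c * x ^ 2 + lam * (|b k + x| - |b k|) - 2 * g * x := by
      intro x
      have h1 := hb (b + x • Pi.single k 1)
      rw [lassoObjective_add, Finset.sum_eq_single k] at h1
      · simp only [mulVec_smul, smul_dotProduct, dotProduct_smul, ← hc, ← hg, smul_eq_mul,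
          Pi.smul_apply, Pi.single_eq_same, mul_one] at h1
        nlinarith
      · intro i _ hi
        simp [Pi.single_eq_of_ne hi]
      · simp
    constructor
    · have : |2 * g| ≤ lam := le_of_forall_quadratic_nonneg (c := c) fun x => by
        have h1 := hdir x
        have h2 : |b k + x| - |b k| ≤ |x| := by linarith [abs_add_le (b k) x]
        nlinarith
      rw [abs_mul, abs_two] at this
      linarith
    · intro hbk
      have h0 : lam * Real.sign (b k) - 2 * g = 0 := by
        refine eq_zero_of_forall_quadratic_nonneg (c := c) (abs_pos.2 hbk) fun x hx => ?_
        have h1 := hdir x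
        have h2 : |b k + x| - |b k| = Real.sign (b k) * x := by
          rcases lt_or_gt_of_ne hbk with h | h
          · rw [abs_of_neg h] at hx ⊢
            rw [Real.sign_of_neg h, abs_of_neg (by linarith [(abs_lt.1 hx).2])]
            ring
          · rw [abs_of_pos h] at hx ⊢
            rw [Real.sign_of_pos h, abs_of_pos (by linarith [(abs_lt.1 hx).1])]
            ring
        rw [h2] at h1
        nlinarith
      linarith
  · intro hk b'
    obtain ⟨h, rfl⟩ : ∃ h, b' = b + h := ⟨b' - b, by abel⟩
    rw [lassoObjective_add]
    have h1 : 0 ≤ (X *ᵥ h) ⬝ᵥ (X *ᵥ h) := dotProduct_self_star_nonneg _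
    have h2 : 0 ≤ ∑ k, (lam * (|b k + h k| - |b k|) -
        2 * (X.col k ⬝ᵥ (y - X *ᵥ b)) * h k) := by
      refine Finset.sum_nonneg fun k _ => ?_
      obtain ⟨hk1, hk2⟩ := hk k
      set g := X.col k ⬝ᵥ (y - X *ᵥ b)
      have h3 : g * b k = lam / 2 * |b k| := by
        by_cases hb : b k = 0
        · simp [hb]
        · rw [hk2 hb, abs_eq_sign_mul]; ring
      have h4 : g * (b k + h k) ≤ lam / 2 * |b k + h k| :=
        (le_abs_self _).trans (by rw [abs_mul]; gcongr)
      nlinarith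
    linarith

theorem mem_activeSet {k : Fin p} : k ∈ activeSet b ↔ b k ≠ 0 := by
  simp [activeSet]

theorem notMem_activeSet {k : Fin p} : k ∉ activeSet b ↔ b k = 0 := by
  simp [activeSet]

theorem sign_add_eq_of_abs_lt {x e : ℝ} (h : |e| < |x|) : Real.sign (x + e) = Real.sign x := by
  rcases lt_trichotomy x 0 with hx | hx | hx
  · rw [abs_of_neg hx] at h
    rw [Real.sign_of_neg hx, Real.sign_of_neg (by linarith [(abs_lt.1 h).2])]
  · rw [hx, abs_zero] at h
    exact absurd h (not_lt.2 (abs_nonneg e))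
  · rw [abs_of_pos hx] at h
    rw [Real.sign_of_pos hx, Real.sign_of_pos (by linarith [(abs_lt.1 h).1])]

/-- The columns selected by a unique lasso solution are linearly independent: a small move along a
linear relation between them would give another solution. -/
theorem hasIndepCols_activeSet (hlam : 0 < lam) (hb : IsLassoSolution X lam y b)
    (huniq : ∀ b', IsLassoSolution X lam y b' → b' = b) : HasIndepCols X (activeSet b) := by
  intro w hw hXw
  have hev : ∀ᶠ t : ℝ in nhds 0, ∀ k, b k ≠ 0 → |t * w k| < |b k| := by
    rw [Filter.eventually_all]
    intro k
    by_cases hk : b k = 0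
    · exact Filter.Eventually.of_forall fun _ h => absurd hk h
    · have : Filter.Tendsto (fun t : ℝ => |t * w k|) (nhds 0) (nhds |0 * w k|) :=
        (Continuous.tendsto (by fun_prop) 0)
      rw [zero_mul, abs_zero] at this
      filter_upwards [this.eventually (gt_mem_nhds (abs_pos.2 hk))] with t ht _ using ht
  obtain ⟨t, ht, ht0⟩ : ∃ t : ℝ, (∀ k, b k ≠ 0 → |t * w k| < |b k|) ∧ 0 < t := by
    have := (hev.filter_mono (nhdsWithin_le_nhds (s := Set.Ioi 0))).and
      (self_mem_nhdsWithin (s := Set.Ioi (0 : ℝ)))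
    exact this.exists
  have hsol : IsLassoSolution X lam y (b + t • w) := by
    rw [isLassoSolution_iff hlam] at hb ⊢
    rw [mulVec_add, mulVec_smul, hXw, smul_zero, add_zero]
    refine fun k => ⟨(hb k).1, fun hk => ?_⟩
    have hbk : b k ≠ 0 := fun h0 => hk (by simp [h0, hw k (notMem_activeSet.2 h0)])
    rw [(hb k).2 hbk, Pi.add_apply, Pi.smul_apply, smul_eq_mul, sign_add_eq_of_abs_lt (ht k hbk)]
  have h1 := huniq _ hsol
  have h2 : t • w = 0 := by simpa using h1
  exact (smul_eq_zero.1 h2).resolve_left ht0.ne'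

theorem lasso_spec (huniq : ∃! b, IsLassoSolution X lam y b) :
    IsLassoSolution X lam y (lasso X lam y) ∧
      ∀ b', IsLassoSolution X lam y b' → b' = lasso X lam y := by
  have h : IsLassoSolution X lam y (lasso X lam y) := Classical.epsilon_spec huniq.exists
  exact ⟨h, fun b' hb' => huniq.unique hb' h⟩

/-- The active coefficients that solve the stationarity equations of the lasso for the set `S` and
the signs `s`. -/
noncomputable def activeCoef (X : Matrix (Fin n) (Fin p) ℝ) (lam : ℝ) (S : Finset (Fin p))
    (s : {k // k ∈ S} → ℝ) (y : Fin n → ℝ) : {k // k ∈ S} → ℝ :=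
  ((colSub X S)ᵀ * colSub X S)⁻¹ *ᵥ ((colSub X S)ᵀ *ᵥ y - (lam / 2) • s)

variable {S : Finset (Fin p)} {s : {k // k ∈ S} → ℝ}

/-- The polyhedron of responses for which the lasso selects the set `S` with signs `s`. -/
def selectionRegion (X : Matrix (Fin n) (Fin p) ℝ) (lam : ℝ) (S : Finset (Fin p))
    (s : {k // k ∈ S} → ℝ) : Set (Fin n → ℝ) :=
  {y | (∀ i, (activeMat X S s *ᵥ y) i < activeBound X lam S s i) ∧
    ∀ i, (inactiveMat X lam S *ᵥ y) i ≤ inactiveBound X S s i}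

theorem measurableSet_selectionRegion (X : Matrix (Fin n) (Fin p) ℝ) (lam : ℝ)
    (S : Finset (Fin p)) (s : {k // k ∈ S} → ℝ) : MeasurableSet (selectionRegion X lam S s) :=
  measurableSet_constraints _ _ _ _

theorem activeMat_lt_iff (k : {k // k ∈ S}) :
    (activeMat X S s *ᵥ y) k < activeBound X lam S s k ↔ 0 < s k * activeCoef X lam S s y k := by
  have h1 : (activeMat X S s *ᵥ y) k =
      -(s k * (((colSub X S)ᵀ * colSub X S)⁻¹ *ᵥ ((colSub X S)ᵀ *ᵥ y)) k) := by
    rw [activeMat, neg_mulVec, ← mulVec_mulVec, ← mulVec_mulVec, Pi.neg_apply, mulVec_diagonal]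
  have h2 : activeBound X lam S s k =
      -(lam / 2 * (s k * (((colSub X S)ᵀ * colSub X S)⁻¹ *ᵥ s) k)) := by
    rw [activeBound, ← mulVec_mulVec, Pi.smul_apply, mulVec_diagonal, smul_eq_mul, neg_mul]
  rw [h1, h2, activeCoef, mulVec_sub, mulVec_smul, Pi.sub_apply, Pi.smul_apply, smul_eq_mul]
  constructor <;> intro h <;> linarith

theorem sub_mulVec_activeCoef :
    y - colSub X S *ᵥ activeCoef X lam S s y = (1 - projMat (colSub X S)) *ᵥ y +
      (lam / 2) • ((colSub X S * ((colSub X S)ᵀ * colSub X S)⁻¹) *ᵥ s) := by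
  rw [activeCoef, mulVec_sub, mulVec_sub, mulVec_smul, mulVec_smul, mulVec_mulVec, mulVec_mulVec,
    mulVec_mulVec, sub_mulVec, one_mulVec, projMat]
  abel

theorem inactiveMat_le_iff (hlam : 0 < lam) :
    (∀ i, (inactiveMat X lam S *ᵥ y) i ≤ inactiveBound X S s i) ↔
      ∀ k ∉ S, |X.col k ⬝ᵥ (y - colSub X S *ᵥ activeCoef X lam S s y)| ≤ lam / 2 := by
  have hval : ∀ k : {k // k ∉ S}, X.col k ⬝ᵥ (y - colSub X S *ᵥ activeCoef X lam S s y) =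
      (((colCompl X S)ᵀ * (1 - projMat (colSub X S))) *ᵥ y) k +
        lam / 2 * inactiveShift X S s k := by
    intro k
    rw [sub_mulVec_activeCoef, dotProduct_add, dotProduct_smul, inactiveShift,
      ← mulVec_mulVec _ (colCompl X S)ᵀ,
      ← mulVec_mulVec _ (colCompl X S)ᵀ]
    rfl
  have hl : 0 < lam / 2 := by positivity
  have hmat : ∀ v : {k // k ∉ S} → ℝ, ∀ k, ((lam / 2)⁻¹ * v k ≤ 1 - inactiveShift X S s k ↔
      v k + lam / 2 * inactiveShift X S s k ≤ lam / 2) ∧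
      ((lam / 2)⁻¹ * -v k ≤ 1 + inactiveShift X S s k ↔
      -(lam / 2) ≤ v k + lam / 2 * inactiveShift X S s k) := by
    intro v k
    rw [inv_mul_le_iff₀ hl, inv_mul_le_iff₀ hl]
    constructor <;> constructor <;> intro h <;> linarith
  simp only [inactiveMat, smul_mulVec, fromRows_mulVec, neg_mulVec, inactiveBound, Sum.forall,
    Pi.smul_apply, Sum.elim_inl, Sum.elim_inr, Pi.neg_apply, smul_eq_mul, (hmat _ _).1,
    (hmat _ _).2]
  constructor
  · rintro ⟨h1, h2⟩ k hk
    rw [hval ⟨k, hk⟩, abs_le]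
    exact ⟨h2 _, h1 _⟩
  · intro h
    refine ⟨fun k => ?_, fun k => ?_⟩
    · have := h k k.2
      rw [hval, abs_le] at this
      exact this.2
    · have := h k k.2
      rw [hval, abs_le] at this
      exact this.1

theorem transpose_mulVec_sub_activeCoef (h : HasIndepCols X S) :
    (colSub X S)ᵀ *ᵥ (y - colSub X S *ᵥ activeCoef X lam S s y) = (lam / 2) • s := by
  rw [sub_mulVec_activeCoef, mulVec_add, transpose_mulVec_compl_projMat h.injective, zero_add,
    mulVec_smul, mulVec_mulVec, ← Matrix.mul_assoc,
    Matrix.mul_nonsing_inv _ (isUnit_det_gram h.injective), one_mulVec]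

/-- Under uniqueness, the lasso selects `S` with signs `s` exactly on the selection region. -/
theorem lassoSet_lassoSign_iff (hlam : 0 < lam) (huniq : ∃! b, IsLassoSolution X lam y b)
    (h : HasIndepCols X S) (hs : ∀ k, s k = 1 ∨ s k = -1) :
    (lassoSet X lam y = S ∧ lassoSign X lam y S = s) ↔ y ∈ selectionRegion X lam S s := by
  obtain ⟨hsol, hunique⟩ := lasso_spec huniq
  have hsel : y ∈ selectionRegion X lam S s ↔ (∀ k, 0 < s k * activeCoef X lam S s y k) ∧
      ∀ k ∉ S, |X.col k ⬝ᵥ (y - colSub X S *ᵥ activeCoef X lam S s y)| ≤ lam / 2 := by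
    rw [← inactiveMat_le_iff hlam]
    simp only [selectionRegion, Set.mem_ofPred_eq, activeMat_lt_iff]
  rw [hsel]
  constructor
  · rintro ⟨hS, hsgn⟩
    set b := lasso X lam y with hb
    have hb0 : ∀ k ∉ S, b k = 0 := fun k hk => notMem_activeSet.1 (by rwa [← hS] at hk)
    have hbne : ∀ k ∈ S, b k ≠ 0 := fun k hk => mem_activeSet.1 (by rwa [← hS] at hk)
    have hsk : ∀ k : {k // k ∈ S}, s k = Real.sign (b k) := fun k => by rw [← hsgn]; rfl
    rw [isLassoSolution_iff hlam] at hsol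
    have hXb : X *ᵥ b = colSub X S *ᵥ fun k => b k := (colSub_mulVec_restrict X hb0).symm
    have hcoef : activeCoef X lam S s y = fun k : {k // k ∈ S} => b k := by
      have h1 : (colSub X S)ᵀ *ᵥ (y - X *ᵥ b) = (lam / 2) • s := by
        ext k
        rw [Pi.smul_apply, smul_eq_mul, hsk, ← (hsol k).2 (hbne k k.2)]
        rfl
      have h2 : (colSub X S)ᵀ *ᵥ y - (lam / 2) • s =
          ((colSub X S)ᵀ * colSub X S) *ᵥ fun k : {k // k ∈ S} => b k := by
        rw [← h1, mulVec_sub, hXb, mulVec_mulVec]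
        abel
      rw [activeCoef, h2, mulVec_mulVec, Matrix.nonsing_inv_mul _ (isUnit_det_gram h.injective),
        one_mulVec]
    rw [hcoef, ← hXb]
    refine ⟨fun k => ?_, fun k _ => (hsol k).1⟩
    rw [hsk, ← abs_eq_sign_mul]
    exact abs_pos.2 (hbne k k.2)
  · rintro ⟨h1, h2⟩
    set b := extendZero S (activeCoef X lam S s y) with hb
    have hsgn : ∀ k : {k // k ∈ S}, Real.sign (b k) = s k := by
      intro k
      have := h1 k
      rw [hb, extendZero_coe]
      rcases hs k with hk | hk
      · rw [hk] at this ⊢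
        exact Real.sign_of_pos (by linarith)
      · rw [hk] at this ⊢
        exact Real.sign_of_neg (by linarith)
    have hbne : ∀ k ∈ S, b k ≠ 0 := by
      intro k hk h0
      have := h1 ⟨k, hk⟩
      rw [hb, show k = ((⟨k, hk⟩ : {k // k ∈ S}) : Fin p) from rfl, extendZero_coe] at h0
      rw [h0, mul_zero] at this
      exact lt_irrefl _ this
    have hgrad : ∀ k : {k // k ∈ S}, X.col k ⬝ᵥ (y - X *ᵥ b) = lam / 2 * s k := by
      intro k
      have := congrFun (transpose_mulVec_sub_activeCoef (y := y) (lam := lam) (s := s) h) k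
      rw [colSub_mulVec] at this
      exact this
    have hsolb : IsLassoSolution X lam y b := by
      rw [isLassoSolution_iff hlam]
      intro k
      by_cases hk : k ∈ S
      · have h3 := hgrad ⟨k, hk⟩
        have h4 := hsgn ⟨k, hk⟩
        simp only at h3 h4
        refine ⟨?_, fun _ => by rw [h3, h4]⟩
        rw [h3, abs_mul, abs_of_pos (by positivity : 0 < lam / 2)]
        rcases hs ⟨k, hk⟩ with e | e <;> rw [e] <;> simp
      · refine ⟨?_, fun h0 => absurd (extendZero_of_notMem _ hk) h0⟩
        rw [hb, ← colSub_mulVec]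
        exact h2 k hk
    have hbl := hunique b hsolb
    refine ⟨?_, ?_⟩
    · rw [lassoSet, ← hbl]
      ext k
      rw [mem_activeSet]
      exact ⟨fun h0 => by_contra fun hk => h0 (extendZero_of_notMem _ hk), hbne k⟩
    · ext k
      rw [lassoSign, ← hbl, hsgn]

theorem lassoSign_eq_one_or (hS : lassoSet X lam y = S) (k : {k // k ∈ S}) :
    lassoSign X lam y S k = 1 ∨ lassoSign X lam y S k = -1 := by
  have : lasso X lam y k ≠ 0 := mem_activeSet.1 (by rw [← lassoSet, hS]; exact k.2)
  exact (Real.sign_apply_eq_of_ne_zero _ this).symm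

end Lasso

/-! ### Screening -/

section Screening

variable {n p : ℕ} {X : Matrix (Fin n) (Fin p) ℝ} {lam : ℝ} {β b : Fin p → ℝ} {ε : Fin n → ℝ}

/-- The basic inequality of the lasso: if the correlations of the noise with the columns are at most
`lam / 4`, then the estimation error lies in the cone of the compatibility condition. -/
theorem lasso_basic_inequality (hlam : 0 < lam)
    (hb : lassoObjective X lam (X *ᵥ β + ε) b ≤ lassoObjective X lam (X *ᵥ β + ε) β)
    (hε : ∀ k, |X.col k ⬝ᵥ ε| ≤ lam / 4) :
    (X *ᵥ (b - β)) ⬝ᵥ (X *ᵥ (b - β)) + lam / 2 * ∑ k ∈ (activeSet β)ᶜ, |(b - β) k| ≤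
      3 / 2 * lam * ∑ k ∈ activeSet β, |(b - β) k| := by
  set δ := b - β with hδ
  have hbδ : b = β + δ := by rw [hδ]; abel
  rw [hbδ, lassoObjective_add, add_sub_cancel_left, ← Finset.sum_add_sum_compl (activeSet β)] at hb
  have hcorr : ∀ k, 2 * (X.col k ⬝ᵥ ε) * δ k ≤ lam / 2 * |δ k| := by
    intro k
    have h1 : (X.col k ⬝ᵥ ε) * δ k ≤ lam / 4 * |δ k| :=
      (le_abs_self _).trans
        (by rw [abs_mul]; exact mul_le_mul_of_nonneg_right (hε k) (abs_nonneg _))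
    linarith
  have h1 : ∑ k ∈ activeSet β, -(3 / 2 * lam * |δ k|) ≤
      ∑ k ∈ activeSet β, (lam * (|β k + δ k| - |β k|) - 2 * (X.col k ⬝ᵥ ε) * δ k) := by
    refine Finset.sum_le_sum fun k _ => ?_
    have h2 : |β k| ≤ |β k + δ k| + |δ k| := by
      have := abs_add_le (β k + δ k) (-δ k)
      rwa [add_neg_cancel_right, abs_neg] at this
    nlinarith [hcorr k]
  have h2 : ∑ k ∈ (activeSet β)ᶜ, lam / 2 * |δ k| ≤
      ∑ k ∈ (activeSet β)ᶜ, (lam * (|β k + δ k| - |β k|) - 2 * (X.col k ⬝ᵥ ε) * δ k) := by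
    refine Finset.sum_le_sum fun k hk => ?_
    rw [Finset.mem_compl, notMem_activeSet] at hk
    rw [hk, zero_add, abs_zero, sub_zero]
    linarith [hcorr k]
  rw [Finset.sum_neg_distrib, ← Finset.mul_sum] at h1
  rw [← Finset.mul_sum] at h2
  linarith

/-- The `ℓ₁` bound for the error of the lasso on the true support. -/
theorem sum_abs_error_le (hlam : 0 < lam) (hn : 0 < n)
    (hb : lassoObjective X lam (X *ᵥ β + ε) b ≤ lassoObjective X lam (X *ᵥ β + ε) β)
    (hε : ∀ k, |X.col k ⬝ᵥ ε| ≤ lam / 4) {φ₀ : ℝ} (hφ : 0 < φ₀)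
    (hcomp : CompatibilityCondition X β φ₀) :
    ∑ k ∈ activeSet β, |(b - β) k| ≤ 2 * lam * ((activeSet β).card / φ₀ ^ 2 * (1 / n)) := by
  have hbasic := lasso_basic_inequality hlam hb hε
  set Q := (X *ᵥ (b - β)) ⬝ᵥ (X *ᵥ (b - β)) with hQ
  have hQ0 : 0 ≤ Q := dotProduct_self_star_nonneg _
  set D₀ := ∑ k ∈ (activeSet β)ᶜ, |(b - β) k|
  set D₁ := ∑ k ∈ activeSet β, |(b - β) k|
  have hD₀ : 0 ≤ D₀ := Finset.sum_nonneg fun _ _ => abs_nonneg _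
  have hD₁ : 0 ≤ D₁ := Finset.sum_nonneg fun _ _ => abs_nonneg _
  have hcone : D₀ ≤ 3 * D₁ := by
    have : lam / 2 * D₀ ≤ lam / 2 * (3 * D₁) := by linarith
    exact le_of_mul_le_mul_left this (by positivity)
  have h1 := hcomp (b - β) hcone
  change D₁ ^ 2 ≤ ((activeSet β).card / φ₀ ^ 2 : ℝ) * ((1 / n : ℝ) * Q) at h1
  rw [← mul_assoc] at h1
  set K : ℝ := (activeSet β).card / φ₀ ^ 2 * (1 / n) with hK
  have hK0 : 0 ≤ K := by positivity
  rcases hK0.eq_or_lt with h0 | h0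
  · rw [← h0, zero_mul] at h1
    rw [← h0]
    nlinarith
  · -- complete the square in `2 lam D₁ ≤ D₁² / K + lam² K`
    have h2 : K * (lam / 2 * D₁) ≤ K * (lam ^ 2 * K) := by
      nlinarith [sq_nonneg (D₁ - lam * K), mul_nonneg (mul_nonneg h0.le hlam.le) hD₀,
        mul_le_mul_of_nonneg_left hbasic h0.le]
    have h3 := le_of_mul_le_mul_left h2 h0
    have h4 : lam / 2 * D₁ ≤ lam / 2 * (2 * lam * K) := by linarith
    exact le_of_mul_le_mul_left h4 (by positivity)

/-- On the event that the noise correlations are small, the `ℓ₁` error is below the signal strength,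
so that no true signal is estimated by zero. -/
theorem activeSet_subset_of_lassoSolution {σ : ℝ} (hσ : 0 < σ) (hlam : 0 < lam) (hn : 0 < n)
    (hb : IsLassoSolution X lam (X *ᵥ β + ε) b) (hε : ∀ k, |X.col k ⬝ᵥ ε| ≤ lam / 4)
    {φ₀ : ℝ} (hφ : 0 < φ₀) (hcomp : CompatibilityCondition X β φ₀)
    (hsig : SignalStrength n β σ φ₀) (hlam' : lam = 2 * n * (4 * σ * √(Real.log p / n))) :
    activeSet β ⊆ activeSet b := by
  intro k hk
  rw [mem_activeSet]
  intro h0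
  have h1 := sum_abs_error_le hlam hn (hb β) hε hφ hcomp
  have h2 : |(b - β) k| ≤ ∑ k ∈ activeSet β, |(b - β) k| :=
    Finset.single_le_sum (f := fun k => |(b - β) k|) (fun _ _ => abs_nonneg _) hk
  rw [Pi.sub_apply, h0, zero_sub, abs_neg] at h2
  have h3 := hsig k hk
  have h4 : 2 * lam * ((activeSet β).card / φ₀ ^ 2 * (1 / n)) =
      16 * σ * (activeSet β).card / φ₀ ^ 2 * √(Real.log p / n) := by
    have : (n : ℝ) ≠ 0 := by positivity
    rw [hlam']
    field_simp
    ring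
  have h5 : 0 ≤ σ * (activeSet β).card / φ₀ ^ 2 * √(Real.log p / n) := by positivity
  have h6 : 64 * σ * (activeSet β).card / φ₀ ^ 2 * √(Real.log p / n) =
      64 * (σ * (activeSet β).card / φ₀ ^ 2 * √(Real.log p / n)) := by ring
  have h7 : 16 * σ * (activeSet β).card / φ₀ ^ 2 * √(Real.log p / n) =
      16 * (σ * (activeSet β).card / φ₀ ^ 2 * √(Real.log p / n)) := by ring
  linarith

theorem IsNormalizedDesign.col_dotProduct_self (hX : IsNormalizedDesign X) (hn : 0 < n)
    (k : Fin p) : X.col k ⬝ᵥ X.col k = n := by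
  have h := (hX k).2
  have : (n : ℝ) ≠ 0 := by positivity
  have e : X.col k ⬝ᵥ X.col k = ∑ i, X i k ^ 2 := by
    simp [dotProduct, sq]
  rw [e]
  field_simp at h
  exact h

theorem IsNormalizedDesign.pos (hX : IsNormalizedDesign X) (k : Fin p) : 0 < n := by
  rcases Nat.eq_zero_or_pos n with h0 | h0
  · subst h0
    have := (hX k).2
    simp at this
  · exact h0

theorem measureReal_abs_ge_le_of_map_eq_gaussianReal {Ω : Type*} [MeasurableSpace Ω]
    {μ : Measure Ω} [IsProbabilityMeasure μ] {Y : Ω → ℝ} {v : NNReal}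
    (hlaw : μ.map Y = gaussianReal 0 v) {x : ℝ} (hx : 0 ≤ x) :
    μ.real {ω | x ≤ |Y ω|} ≤ 2 * Real.exp (-x ^ 2 / (2 * v)) := by
  have hY : AEMeasurable Y μ := aemeasurable_of_map_neZero (by rw [hlaw]; infer_instance)
  have hlaw' : μ.map (fun ω => -Y ω) = gaussianReal 0 v := by
    have := AEMeasurable.map_map_of_aemeasurable (g := fun x : ℝ => -x)
      (measurable_neg.aemeasurable) hY
    rw [hlaw, gaussianReal_map_neg, neg_zero] at this
    exact this.symm
  have hsub : ∀ Y' : Ω → ℝ, μ.map Y' = gaussianReal 0 v → HasSubgaussianMGF Y' v μ := by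
    intro Y' h
    refine ⟨fun t => ?_, fun t => ?_⟩
    · rw [← mgf_pos_iff, mgf_gaussianReal h]
      exact Real.exp_pos _
    · rw [mgf_gaussianReal h, zero_mul, zero_add]
  have h1 := (hsub Y hlaw).measure_ge_le hx
  have h2 := (hsub _ hlaw').measure_ge_le hx
  have h3 : {ω | x ≤ |Y ω|} ⊆ {ω | x ≤ Y ω} ∪ {ω | x ≤ -Y ω} := fun ω (hω : x ≤ |Y ω|) => by
    simpa using le_abs.1 hω
  have h4 := (measureReal_mono (μ := μ) h3).trans (measureReal_union_le _ _)
  linarith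

/-- With probability at least `1 - 2 / p`, the lasso at the prescribed penalty level selects all
true signals. -/
theorem le_measureReal_activeSet_subset_lassoSet {Ω : Type*} [MeasurableSpace Ω] (μ : Measure Ω)
    [IsProbabilityMeasure μ] (hX : IsNormalizedDesign X) {σ : ℝ} (hσ : 0 < σ) (hlam : 0 < lam)
    {ε : Ω → Fin n → ℝ} (hε : Measurable ε)
    (hεlaw : μ.map ε = Measure.pi fun _ => gaussianReal 0 (σ ^ 2).toNNReal)
    (huniq : ∀ᵐ ω ∂μ, ∃! b, IsLassoSolution X lam (X *ᵥ β + ε ω) b)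
    {φ₀ : ℝ} (hφ : 0 < φ₀) (hcomp : CompatibilityCondition X β φ₀)
    (hsig : SignalStrength n β σ φ₀) (hlam' : lam = 2 * n * (4 * σ * √(Real.log p / n))) :
    1 - 2 / (p : ℝ) ≤ μ.real {ω | activeSet β ⊆ lassoSet X lam (X *ᵥ β + ε ω)} := by
  have hn : 0 < n := by
    rcases Nat.eq_zero_or_pos n with h0 | h0
    · subst h0; simp [hlam'] at hlam
    · exact h0
  have hnR : (0 : ℝ) < n := by exact_mod_cast hn
  have hp : 0 < p := by
    rcases Nat.eq_zero_or_pos p with h0 | h0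
    · subst h0; simp [hlam'] at hlam
    · exact h0
  have hpR : (0 : ℝ) < p := by exact_mod_cast hp
  have hlog : 0 ≤ Real.log p := Real.log_natCast_nonneg p
  -- `x_kᵀ ε` has the law `N(0, σ² n)`, and the threshold `lam / 4` gives the exponent `-2 log p`
  have htail : ∀ k, μ.real {ω | lam / 4 ≤ |X.col k ⬝ᵥ ε ω|} ≤ 2 / (p : ℝ) ^ 2 := by
    intro k
    have hlaw : μ.map (fun ω => X.col k ⬝ᵥ ε ω) =
        gaussianReal 0 ((σ ^ 2).toNNReal * (n : ℝ).toNNReal) := by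
      have := map_dotProduct_pi_gaussianReal (σ ^ 2).toNNReal (X.col k)
      rw [hX.col_dotProduct_self hn, ← hεlaw,
        Measure.map_map (measurable_dotProduct measurable_const measurable_id') hε] at this
      exact this
    refine (measureReal_abs_ge_le_of_map_eq_gaussianReal hlaw (by positivity)).trans_eq ?_
    have hexp : -(lam / 4) ^ 2 / (2 * (((σ ^ 2).toNNReal * (n : ℝ).toNNReal : NNReal) : ℝ)) =
        -(2 * Real.log p) := by
      rw [NNReal.coe_mul, Real.coe_toNNReal _ (by positivity), Real.coe_toNNReal _ hnR.le, hlam']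
      have hs : √(Real.log p / n) ^ 2 = Real.log p / n := Real.sq_sqrt (by positivity)
      have : (2 * n * (4 * σ * √(Real.log p / n)) / 4) ^ 2 =
          4 * n ^ 2 * σ ^ 2 * (√(Real.log p / n) ^ 2) := by ring
      rw [this, hs]
      field_simp
      ring
    rw [hexp, Real.exp_neg, two_mul (Real.log p), Real.exp_add, Real.exp_log hpR, ← sq]
    rfl
  have hbad : μ.real (⋃ k, {ω | lam / 4 ≤ |X.col k ⬝ᵥ ε ω|}) ≤ 2 / p := by
    refine (measureReal_iUnion_fintype_le _).trans
      ((Finset.sum_le_sum fun k _ => htail k).trans_eq ?_)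
    rw [Finset.sum_const, Finset.card_univ, Fintype.card_fin, nsmul_eq_mul]
    field_simp
  have hcover : ∀ᵐ ω ∂μ, ω ∈ {ω | activeSet β ⊆ lassoSet X lam (X *ᵥ β + ε ω)} ∪
      ⋃ k, {ω | lam / 4 ≤ |X.col k ⬝ᵥ ε ω|} := by
    filter_upwards [huniq] with ω hω
    by_cases hg : ∀ k, |X.col k ⬝ᵥ ε ω| ≤ lam / 4
    · exact Or.inl (activeSet_subset_of_lassoSolution hσ hlam hn (lasso_spec hω).1 hg hφ hcomp
        hsig hlam')
    · push Not at hg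
      obtain ⟨k, hk⟩ := hg
      exact Or.inr (Set.mem_iUnion.2 ⟨k, hk.le⟩)
  have h1 : μ.real ({ω | activeSet β ⊆ lassoSet X lam (X *ᵥ β + ε ω)} ∪
      ⋃ k, {ω | lam / 4 ≤ |X.col k ⬝ᵥ ε ω|}) = 1 := by
    have e : ({ω | activeSet β ⊆ lassoSet X lam (X *ᵥ β + ε ω)} ∪
        ⋃ k, {ω | lam / 4 ≤ |X.col k ⬝ᵥ ε ω|} : Set Ω) =ᵐ[μ] Set.univ :=
      Filter.eventuallyEq_univ.2 hcover
    rw [measureReal_congr e, probReal_univ]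
  have h2 := measureReal_union_le (μ := μ) {ω | activeSet β ⊆ lassoSet X lam (X *ᵥ β + ε ω)}
    (⋃ k, {ω | lam / 4 ≤ |X.col k ⬝ᵥ ε ω|})
  linarith

end Screening

/-! ### The mirror statistic on a selection outcome -/

section Outcome

variable {n p : ℕ} {X : Matrix (Fin n) (Fin p) ℝ} {S : Finset (Fin p)}

/-- As the columns are centered, the constant vector is orthogonal to `X_S`, so that `z̃` and `z`
have the same sum of coordinates. -/
theorem ae_zTilde_ne_zero (hX : IsNormalizedDesign X) (hn : 0 < n) (S : Finset (Fin p)) :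
    ∀ᵐ z ∂(Measure.pi fun _ : Fin n => gaussianReal 0 1), zTilde X S z ≠ 0 := by
  have hlaw := map_dotProduct_pi_gaussianReal 1 (1 : Fin n → ℝ)
  have hv : (1 : NNReal) * ((1 : Fin n → ℝ) ⬝ᵥ 1).toNNReal ≠ 0 := by
    simp [dotProduct, hn.ne']
  have := nullSingletonClass_gaussianReal (μ := 0) hv
  have h0 : ∀ᵐ x ∂gaussianReal 0 (1 * ((1 : Fin n → ℝ) ⬝ᵥ 1).toNNReal), x ≠ 0 :=
    measure_eq_zero_iff_ae_notMem.1 (measure_singleton 0)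
  rw [← hlaw] at h0
  have h1 := ae_of_ae_map
    (measurable_dotProduct measurable_const measurable_id').aemeasurable h0
  filter_upwards [h1] with z hz hz0
  apply hz
  have hcenter : (colSub X S)ᵀ *ᵥ (1 : Fin n → ℝ) = 0 := by
    ext k
    have := (hX k).1
    simpa [mulVec, dotProduct, colSub] using this
  have e : (1 : Fin n → ℝ) ⬝ᵥ zTilde X S z = 1 ⬝ᵥ z := by
    rw [zTilde, dotProduct_compl_projMat_mulVec, sub_mulVec, one_mulVec,
      projMat_mulVec_eq_zero hcenter, sub_zero]
  rw [← e, hz0, dotProduct_zero]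

variable {Ω : Type*} [MeasurableSpace Ω] {μ : Measure Ω} {lam σ : ℝ} {y : Ω → Fin n → ℝ}
  {s : {k // k ∈ S} → ℝ} {j : Fin p}

/-- The event that the lasso selects the set `S` with signs `s`. -/
def outcome (X : Matrix (Fin n) (Fin p) ℝ) (lam : ℝ) (y : Ω → Fin n → ℝ) (S : Finset (Fin p))
    (s : {k // k ∈ S} → ℝ) : Set Ω :=
  {ω | lassoSet X lam (y ω) = S ∧ lassoSign X lam (y ω) S = s}

theorem ae_mem_outcome_iff (hlam : 0 < lam)
    (huniq : ∀ᵐ ω ∂μ, ∃! b, IsLassoSolution X lam (y ω) b) (S : Finset (Fin p))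
    (s : {k // k ∈ S} → ℝ) :
    ∀ᵐ ω ∂μ, ω ∈ outcome X lam y S s ↔
      (HasIndepCols X S ∧ ∀ k, s k = 1 ∨ s k = -1) ∧ y ω ∈ selectionRegion X lam S s := by
  filter_upwards [huniq] with ω hω
  constructor
  · rintro ⟨hS, hs⟩
    have h1 : HasIndepCols X S := by
      have := hasIndepCols_activeSet hlam (lasso_spec hω).1 (lasso_spec hω).2
      rwa [← lassoSet, hS] at this
    have h2 : ∀ k, s k = 1 ∨ s k = -1 := fun k => by
      rw [← hs]; exact lassoSign_eq_one_or hS k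
    exact ⟨⟨h1, h2⟩, (lassoSet_lassoSign_iff hlam hω h1 h2).1 ⟨hS, hs⟩⟩
  · rintro ⟨⟨h1, h2⟩, h3⟩
    exact (lassoSet_lassoSign_iff hlam hω h1 h2).2 h3

theorem nullMeasurableSet_outcome (hlam : 0 < lam) (hy : Measurable y)
    (huniq : ∀ᵐ ω ∂μ, ∃! b, IsLassoSolution X lam (y ω) b) (S : Finset (Fin p))
    (s : {k // k ∈ S} → ℝ) : NullMeasurableSet (outcome X lam y S s) μ := by
  have h : {ω | (HasIndepCols X S ∧ ∀ k, s k = 1 ∨ s k = -1) ∧ y ω ∈ selectionRegion X lam S s}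
      =ᵐ[μ] outcome X lam y S s := by
    filter_upwards [ae_mem_outcome_iff hlam huniq S s] with ω hω
    exact propext hω.symm
  refine NullMeasurableSet.congr (MeasurableSet.nullMeasurableSet ?_) h
  exact (MeasurableSet.const _).inter (hy (measurableSet_selectionRegion X lam S s))

/-- The mirror statistic of the variable `j` for the outcome `(S, s)`, expressed by contrasts. -/
noncomputable def outcomeStat (X : Matrix (Fin n) (Fin p) ℝ) (lam σ : ℝ) (S : Finset (Fin p))
    (s : {k // k ∈ S} → ℝ) (j : Fin p) (z y : Fin n → ℝ) : ℝ :=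
  pivotStat (σ * √(2 * contrastAlpha X S j)) (contrastAlpha X S j) (activeMat X S s)
    (activeBound X lam S s) (inactiveMat X lam S) (inactiveBound X S s) (sumContrast X S j)
    (diffContrast X S j z) y

theorem measurable_outcomeStat {Ω' : Type*} [MeasurableSpace Ω'] (X : Matrix (Fin n) (Fin p) ℝ)
    (lam σ : ℝ) (S : Finset (Fin p)) (s : {k // k ∈ S} → ℝ) (j : Fin p) {z y : Ω' → Fin n → ℝ}
    (hz : Measurable z) (hy : Measurable y) :
    Measurable fun ω => outcomeStat X lam σ S s j (z ω) (y ω) :=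
  measurable_pivotStat _ _ _ _ _ _ _ ((measurable_diffContrast X S j).comp hz) hy

theorem lassoMirrorStat_eq_mirrorStat {v : Fin n → ℝ} (hS : lassoSet X lam v = S)
    (hs : lassoSign X lam v S = s) (hj : j ∈ S) (z : Fin n → ℝ) :
    lassoMirrorStat X lam σ j z v = mirrorStat X lam σ S s j z v := by
  subst hS
  subst hs
  exact if_pos hj

theorem lassoMirrorStat_eq_zero {v : Fin n → ℝ} (hj : j ∉ lassoSet X lam v) (z : Fin n → ℝ) :
    lassoMirrorStat X lam σ j z v = 0 := if_neg hj

theorem ae_lassoMirrorStat_eq_outcomeStat (hX : IsNormalizedDesign X) (hlam : 0 < lam)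
    (huniq : ∀ᵐ ω ∂μ, ∃! b, IsLassoSolution X lam (y ω) b) {z : Ω → Fin n → ℝ} (hz : Measurable z)
    (hzlaw : μ.map z = Measure.pi fun _ => gaussianReal 0 1) (hj : j ∈ S)
    (s : {k // k ∈ S} → ℝ) :
    ∀ᵐ ω ∂μ, ω ∈ outcome X lam y S s →
      lassoMirrorStat X lam σ j (z ω) (y ω) = outcomeStat X lam σ S s j (z ω) (y ω) := by
  have hz0 : ∀ᵐ ω ∂μ, zTilde X S (z ω) ≠ 0 :=
    ae_of_ae_map hz.aemeasurable (hzlaw ▸ ae_zTilde_ne_zero hX (hX.pos j) S)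
  filter_upwards [hz0, ae_mem_outcome_iff hlam huniq S s] with ω h0 h1 h2
  rw [lassoMirrorStat_eq_mirrorStat h2.1 h2.2 hj, mirrorStat_eq_pivotStat (h1.1 h2).1.1 hj h0,
    outcomeStat]

/-! ### Symmetry on a selection outcome -/

/-- For fixed `z` this is the symmetry for fixed contrasts; integrating over `z ∈ C` gives the claim
for the joint law of the simulated vector and the noise. -/
theorem prod_outcomeStat_symm (hX : IsNormalizedDesign X) (hσ : 0 < σ) (h : HasIndepCols X S)
    (hj : j ∈ S) {β : Fin p → ℝ} (hβj : β j = 0) (hβS : activeSet β ⊆ S)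
    (s : {k // k ∈ S} → ℝ) {C : Set (Fin n → ℝ)} (hC : MeasurableSet C) (t : ℝ) :
    ((Measure.pi fun _ : Fin n => gaussianReal 0 1).prod
      (Measure.pi fun _ : Fin n => gaussianReal 0 (σ ^ 2).toNNReal))
        {q | (q.1 ∈ C ∧ X *ᵥ β + q.2 ∈ selectionRegion X lam S s) ∧
          outcomeStat X lam σ S s j q.1 (X *ᵥ β + q.2) ≤ -t} =
    ((Measure.pi fun _ : Fin n => gaussianReal 0 1).prod
      (Measure.pi fun _ : Fin n => gaussianReal 0 (σ ^ 2).toNNReal))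
        {q | (q.1 ∈ C ∧ X *ᵥ β + q.2 ∈ selectionRegion X lam S s) ∧
          t ≤ outcomeStat X lam σ S s j q.1 (X *ᵥ β + q.2)} := by
  have hshift : Measurable fun q : (Fin n → ℝ) × (Fin n → ℝ) => X *ᵥ β + q.2 :=
    measurable_const.add measurable_snd
  have hstat : Measurable fun q : (Fin n → ℝ) × (Fin n → ℝ) =>
      outcomeStat X lam σ S s j q.1 (X *ᵥ β + q.2) :=
    measurable_outcomeStat X lam σ S s j measurable_fst hshift
  have hR : MeasurableSet {q : (Fin n → ℝ) × (Fin n → ℝ) | q.1 ∈ C ∧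
      X *ᵥ β + q.2 ∈ selectionRegion X lam S s} :=
    (measurable_fst hC).inter (hshift (measurableSet_selectionRegion X lam S s))
  have hm₁ := hR.inter (measurableSet_le hstat (measurable_const (a := -t)))
  have hm₂ := hR.inter (measurableSet_le (measurable_const (a := t)) hstat)
  refine (Measure.prod_apply hm₁).trans (Eq.trans ?_ (Measure.prod_apply hm₂).symm)
  refine lintegral_congr_ae ?_
  filter_upwards [ae_zTilde_ne_zero hX (hX.pos j) S] with z hz
  by_cases hzC : z ∈ C
  · have hβ₁ : ∀ k ∉ S.erase j, β k = 0 := by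
      intro k hk
      by_cases hkj : k = j
      · rw [hkj, hβj]
      · exact notMem_activeSet.1 fun hk' => hk (Finset.mem_erase.2 ⟨hkj, hβS hk'⟩)
    have hβ₂ : ∀ k ∉ S, β k = 0 := fun k hk => hβ₁ k fun hk' => hk (Finset.mem_of_mem_erase hk')
    have := pivotStat_symm hσ (contrastAlpha_pos h hj) (activeMat X S s) (activeBound X lam S s)
      (inactiveMat X lam S) (inactiveBound X S s) (sumContrast_dotProduct_self h hj)
      (diffContrast_dotProduct_self h hj hz) (sumContrast_dotProduct_diffContrast h hj z)
      (sumContrast_dotProduct_mulVec h hβ₁) (diffContrast_dotProduct_mulVec h z hβ₂)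
      (activeMat_mulVec_diffContrast h s z) (inactiveMat_mulVec_sumContrast h hj lam) t
    convert this using 2
    · ext ε
      simp only [Set.mem_preimage, Set.mem_inter_iff, Set.mem_ofPred_eq, hzC, true_and,
        selectionRegion, outcomeStat]
    · ext ε
      simp only [Set.mem_preimage, Set.mem_inter_iff, Set.mem_ofPred_eq, hzC, true_and,
        selectionRegion, outcomeStat]
  · congr 1
    ext ε
    simp [hzC]

/-- On every outcome that contains the true signals, the mirror statistic of a null variable is
symmetric jointly with the simulated vector. -/
theorem measure_outcome_symm [IsProbabilityMeasure μ] (hX : IsNormalizedDesign X) (hσ : 0 < σ)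
    (hlam : 0 < lam) {β : Fin p → ℝ} {ε : Ω → Fin n → ℝ} (hε : Measurable ε)
    (hεlaw : μ.map ε = Measure.pi fun _ => gaussianReal 0 (σ ^ 2).toNNReal)
    {z : Ω → Fin n → ℝ} (hz : Measurable z)
    (hzlaw : μ.map z = Measure.pi fun _ => gaussianReal 0 1) (hindep : IndepFun ε z μ)
    (huniq : ∀ᵐ ω ∂μ, ∃! b, IsLassoSolution X lam (X *ᵥ β + ε ω) b) (hβj : β j = 0)
    (hβS : activeSet β ⊆ S) (s : {k // k ∈ S} → ℝ) {C : Set (Fin n → ℝ)} (hC : MeasurableSet C)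
    {t : ℝ} (ht : 0 < t) :
    μ ({ω | lassoMirrorStat X lam σ j (z ω) (X *ᵥ β + ε ω) ≤ -t} ∩ z ⁻¹' C ∩
        outcome X lam (fun ω => X *ᵥ β + ε ω) S s) =
      μ ({ω | t ≤ lassoMirrorStat X lam σ j (z ω) (X *ᵥ β + ε ω)} ∩ z ⁻¹' C ∩
        outcome X lam (fun ω => X *ᵥ β + ε ω) S s) := by
  by_cases hj : j ∈ S
  swap
  · -- the statistic vanishes on the outcome, so neither event meets it
    have hzero : ∀ ω ∈ outcome X lam (fun ω => X *ᵥ β + ε ω) S s,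
        lassoMirrorStat X lam σ j (z ω) (X *ᵥ β + ε ω) = 0 := fun ω hω =>
      lassoMirrorStat_eq_zero (by rw [hω.1]; exact hj) _
    congr 1
    ext ω
    simp only [Set.mem_inter_iff, Set.mem_ofPred_eq, and_assoc]
    constructor <;> rintro ⟨h1, h2, h3⟩ <;> rw [hzero ω h3] at h1 <;> linarith
  have hiff := ae_mem_outcome_iff hlam huniq S s
  have hstat := ae_lassoMirrorStat_eq_outcomeStat (σ := σ) hX hlam huniq hz hzlaw hj s
  by_cases hadm : HasIndepCols X S ∧ ∀ k, s k = 1 ∨ s k = -1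
  swap
  · have h0 : μ (outcome X lam (fun ω => X *ᵥ β + ε ω) S s) = 0 := by
      rw [measure_eq_zero_iff_ae_notMem]
      filter_upwards [hiff] with ω hω h
      exact hadm (hω.1 h).1
    rw [measure_mono_null Set.inter_subset_right h0, measure_mono_null Set.inter_subset_right h0]
  have hjoint : μ.map (fun ω => (z ω, ε ω)) =
      (Measure.pi fun _ : Fin n => gaussianReal 0 1).prod
        (Measure.pi fun _ : Fin n => gaussianReal 0 (σ ^ 2).toNNReal) := by
    rw [(indepFun_iff_map_prod_eq_prod_map_map hz.aemeasurable hε.aemeasurable).1 hindep.symm,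
      hzlaw, hεlaw]
  have key : ∀ I : Set ℝ, MeasurableSet I →
      μ ({ω | lassoMirrorStat X lam σ j (z ω) (X *ᵥ β + ε ω) ∈ I} ∩ z ⁻¹' C ∩
        outcome X lam (fun ω => X *ᵥ β + ε ω) S s) =
      ((Measure.pi fun _ : Fin n => gaussianReal 0 1).prod
        (Measure.pi fun _ : Fin n => gaussianReal 0 (σ ^ 2).toNNReal))
          {q | (q.1 ∈ C ∧ X *ᵥ β + q.2 ∈ selectionRegion X lam S s) ∧
            outcomeStat X lam σ S s j q.1 (X *ᵥ β + q.2) ∈ I} := by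
    intro I hI
    have hshift : Measurable fun q : (Fin n → ℝ) × (Fin n → ℝ) => X *ᵥ β + q.2 :=
      measurable_const.add measurable_snd
    have hm : MeasurableSet {q : (Fin n → ℝ) × (Fin n → ℝ) |
        (q.1 ∈ C ∧ X *ᵥ β + q.2 ∈ selectionRegion X lam S s) ∧
          outcomeStat X lam σ S s j q.1 (X *ᵥ β + q.2) ∈ I} :=
      ((measurable_fst hC).inter (hshift (measurableSet_selectionRegion X lam S s))).inter
        ((measurable_outcomeStat X lam σ S s j measurable_fst hshift) hI)
    rw [← hjoint, Measure.map_apply (hz.prodMk hε) hm]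
    refine measure_congr ?_
    filter_upwards [hiff, hstat] with ω h1 h2
    refine propext ⟨?_, ?_⟩
    · rintro ⟨⟨h3, h4⟩, h5⟩
      refine ⟨⟨h4, (h1.1 h5).2⟩, ?_⟩
      change outcomeStat X lam σ S s j (z ω) (X *ᵥ β + ε ω) ∈ I
      rw [← h2 h5]
      exact h3
    · rintro ⟨⟨h3, h4⟩, h5⟩
      have h6 := h1.2 ⟨hadm, h4⟩
      refine ⟨⟨?_, h3⟩, h6⟩
      change lassoMirrorStat X lam σ j (z ω) (X *ᵥ β + ε ω) ∈ I
      rw [h2 h6]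
      exact h5
  exact (key (Set.Iic (-t)) measurableSet_Iic).trans
    ((prod_outcomeStat_symm hX hσ hadm.1 hj hβj hβS s hC t).trans
      (key (Set.Ici t) measurableSet_Ici).symm)

/-! ### Decomposition into outcomes -/

/-- The signs encoded by a Boolean vector. -/
def boolSign (f : {k // k ∈ S} → Bool) : {k // k ∈ S} → ℝ :=
  fun k => if f k then 1 else -1

theorem injective_boolSign : Function.Injective (boolSign (S := S)) := by
  intro f g hfg
  ext k
  have := congrFun hfg k
  simp only [boolSign] at this
  cases hf : f k <;> cases hg : g k <;> simp [hf, hg] at this ⊢ <;> norm_num at this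

theorem exists_boolSign_eq {s : {k // k ∈ S} → ℝ} (hs : ∀ k, s k = 1 ∨ s k = -1) :
    ∃ f, boolSign f = s := by
  classical
  refine ⟨fun k => decide (s k = 1), ?_⟩
  ext k
  rcases hs k with h | h
  · simp [boolSign, h]
  · simp [boolSign, h]
    norm_num

/-- Every sample point lies in one of finitely many outcomes, indexed by sets with Boolean signs. -/
theorem exists_mem_outcome {Ω : Type*} (X : Matrix (Fin n) (Fin p) ℝ) (lam : ℝ)
    (y : Ω → Fin n → ℝ) (ω : Ω) :
    ∃ f, ω ∈ outcome X lam y (lassoSet X lam (y ω)) (boolSign f) := by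
  obtain ⟨f, hf⟩ := exists_boolSign_eq (lassoSign_eq_one_or (X := X) (lam := lam) (y := y ω) rfl)
  exact ⟨f, rfl, hf.symm⟩

theorem pairwise_disjoint_outcome {Ω : Type*} (X : Matrix (Fin n) (Fin p) ℝ) (lam : ℝ)
    (y : Ω → Fin n → ℝ) :
    Pairwise (Function.onFun Disjoint
      fun o : Σ S : Finset (Fin p), ({k // k ∈ S} → Bool) =>
        outcome X lam y o.1 (boolSign o.2)) := by
  rintro ⟨S, f⟩ ⟨T, g⟩ hne
  rw [Function.onFun, Set.disjoint_left]
  rintro ω ⟨h1, h2⟩ ⟨h3, h4⟩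
  simp only at h1 h2 h3 h4
  have : S = T := h1.symm.trans h3
  subst this
  exact hne (by rw [injective_boolSign (h2.symm.trans h4)])

theorem aemeasurable_lassoMirrorStat (hX : IsNormalizedDesign X) (hlam : 0 < lam)
    (hy : Measurable y) (huniq : ∀ᵐ ω ∂μ, ∃! b, IsLassoSolution X lam (y ω) b)
    {z : Ω → Fin n → ℝ} (hz : Measurable z)
    (hzlaw : μ.map z = Measure.pi fun _ => gaussianReal 0 1) (σ : ℝ) (j : Fin p) :
    AEMeasurable (fun ω => lassoMirrorStat X lam σ j (z ω) (y ω)) μ := by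
  have hcover : (⋃ o : Σ S : Finset (Fin p), ({k // k ∈ S} → Bool),
      outcome X lam y o.1 (boolSign o.2)) = Set.univ := by
    refine Set.eq_univ_of_forall fun ω => ?_
    obtain ⟨f, hf⟩ := exists_mem_outcome X lam y ω
    exact Set.mem_iUnion.2 ⟨⟨_, f⟩, hf⟩
  rw [← Measure.restrict_univ (μ := μ), ← hcover, aemeasurable_iUnion_iff]
  rintro ⟨S, f⟩
  have hnull := nullMeasurableSet_outcome hlam hy huniq S (boolSign f)
  by_cases hj : j ∈ S
  · refine ⟨fun ω => outcomeStat X lam σ S (boolSign f) j (z ω) (y ω),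
      measurable_outcomeStat X lam σ S _ j hz hy, ?_⟩
    exact (ae_restrict_iff'₀ hnull).2
      (ae_lassoMirrorStat_eq_outcomeStat hX hlam huniq hz hzlaw hj _)
  · refine ⟨fun _ => 0, measurable_const, (ae_restrict_iff'₀ hnull).2 (ae_of_all _ ?_)⟩
    rintro ω ⟨h1, -⟩
    exact lassoMirrorStat_eq_zero (by rw [h1]; exact hj) _

theorem screening_eq_biUnion {Ω : Type*} (X : Matrix (Fin n) (Fin p) ℝ) (lam : ℝ)
    (y : Ω → Fin n → ℝ) (T : Finset (Fin p)) :
    {ω | T ⊆ lassoSet X lam (y ω)} =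
      ⋃ o ∈ Finset.univ.filter fun o : Σ S : Finset (Fin p), ({k // k ∈ S} → Bool) => T ⊆ o.1,
        outcome X lam y o.1 (boolSign o.2) := by
  ext ω
  simp only [Set.mem_ofPred_eq, Set.mem_iUnion, Finset.mem_filter, Finset.mem_univ, true_and,
    exists_prop]
  constructor
  · intro h
    obtain ⟨f, hf⟩ := exists_mem_outcome X lam y ω
    exact ⟨⟨_, f⟩, h, hf⟩
  · rintro ⟨o, ho, hω⟩
    rwa [hω.1]

end Outcome

/-! ### Conditional probabilities -/

section CondProb

variable {Ω E : Type*} [MeasurableSpace Ω] [MeasurableSpace E]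

/-- Two events have the same conditional probability given `z` if their intersections with every
event in the `σ`-algebra of `z` have the same probability. -/
theorem condProb_congr_of_forall_preimage {ν : Measure Ω} [IsFiniteMeasure ν] {z : Ω → E}
    (hz : Measurable z) {A B : Set Ω} (hA : NullMeasurableSet A ν) (hB : NullMeasurableSet B ν)
    (h : ∀ C, MeasurableSet C → ν (A ∩ z ⁻¹' C) = ν (B ∩ z ⁻¹' C)) :
    ν⟦A | MeasurableSpace.comap z inferInstance⟧ =ᵐ[ν]
      ν⟦B | MeasurableSpace.comap z inferInstance⟧ := by
  have hint : ∀ D : Set Ω, NullMeasurableSet D ν →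
      Integrable (D.indicator fun _ => (1 : ℝ)) ν := fun D hD =>
    (integrable_const (1 : ℝ)).indicator₀ hD
  have hset : ∀ D : Set Ω, NullMeasurableSet D ν → ∀ F : Set Ω,
      ∫ ω in F, D.indicator (fun _ => (1 : ℝ)) ω ∂ν = ν.real (D ∩ F) := by
    intro D hD F
    rw [integral_indicator₀ (hD.mono_ac Measure.restrict_le_self.absolutelyContinuous),
      setIntegral_const, smul_eq_mul, mul_one, measureReal_restrict_apply₀
        (hD.mono_ac Measure.restrict_le_self.absolutelyContinuous)]
  refine ae_eq_condExp_of_forall_setIntegral_eq hz.comap_le (hint B hB)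
    (fun F _ _ => integrable_condExp.integrableOn) ?_
    stronglyMeasurable_condExp.aestronglyMeasurable
  rintro F hF -
  rw [setIntegral_condExp hz.comap_le (hint A hA) hF, hset A hA, hset B hB]
  obtain ⟨C, hC, rfl⟩ := hF
  rw [measureReal_def, measureReal_def, h C hC]

theorem condProb_cond_congr {μ : Measure Ω} [IsProbabilityMeasure μ] {z : Ω → E}
    (hz : Measurable z) {A B D : Set Ω} (hA : NullMeasurableSet A μ) (hB : NullMeasurableSet B μ)
    (hD : NullMeasurableSet D μ)
    (h : ∀ C, MeasurableSet C → μ (A ∩ z ⁻¹' C ∩ D) = μ (B ∩ z ⁻¹' C ∩ D)) :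
    (μ[|D])⟦A | MeasurableSpace.comap z inferInstance⟧ =ᵐ[μ[|D]]
      (μ[|D])⟦B | MeasurableSpace.comap z inferInstance⟧ := by
  by_cases h0 : μ D = 0
  · rw [cond_eq_zero.2 (Or.inr h0)]
    simp [Filter.EventuallyEq]
  have := cond_isProbabilityMeasure h0
  have hac : μ[|D] ≪ μ := cond_absolutelyContinuous
  refine condProb_congr_of_forall_preimage hz (hA.mono_ac hac) (hB.mono_ac hac) fun C hC => ?_
  simp only [ProbabilityTheory.cond, Measure.smul_apply, Measure.restrict_apply₀' hD, h C hC]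

end CondProb

end GaussianMirror

open GaussianMirror in
theorem theorem3
    {Ω : Type*} [MeasurableSpace Ω] (μ : Measure Ω) [IsProbabilityMeasure μ]
    {n p : ℕ} (X : Matrix (Fin n) (Fin p) ℝ) (hX : IsNormalizedDesign X)
    (β : Fin p → ℝ) (σ : ℝ) (hσ : 0 < σ) (lam : ℝ) (hlam : 0 < lam)
    -- the noise vector has i.i.d. `N(0, σ²)` entries
    (ε : Ω → Fin n → ℝ) (hε : Measurable ε)
    (hεlaw : μ.map ε = Measure.pi fun _ => gaussianReal 0 (σ ^ 2).toNNReal)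
    -- each simulated vector is `N(0, Iₙ)` and independent of the noise
    (Z : Fin p → Ω → Fin n → ℝ) (hZ : ∀ j, Measurable (Z j))
    (hZlaw : ∀ j, μ.map (Z j) = Measure.pi fun _ => gaussianReal 0 1)
    (hindep : ∀ j, IndepFun ε (Z j) μ)
    (y : Ω → Fin n → ℝ) (hy : ∀ ω, y ω = X *ᵥ β + ε ω)
    -- the lasso problem almost surely has exactly one solution
    (huniq : ∀ᵐ ω ∂μ, ∃! b, IsLassoSolution X lam (y ω) b) :
    -- the mirror statistics are random variables
    (∀ j, AEMeasurable (fun ω => lassoMirrorStat X lam σ j (Z j ω) (y ω)) μ) ∧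
    -- symmetry given `z_j`, on each selection outcome `(S, s)` with `S₁ ⊆ S`
    (∀ j, β j = 0 → ∀ S : Finset (Fin p), j ∈ S → activeSet β ⊆ S →
      ∀ s : {k // k ∈ S} → ℝ, ∀ ν : Measure Ω,
        ν = μ[|{ω | lassoSet X lam (y ω) = S ∧ lassoSign X lam (y ω) S = s}] →
        ∀ t : ℝ, 0 < t →
          ν⟦{ω | lassoMirrorStat X lam σ j (Z j ω) (y ω) ≤ -t} |
            MeasurableSpace.comap (Z j) inferInstance⟧ =ᵐ[ν]
          ν⟦{ω | t ≤ lassoMirrorStat X lam σ j (Z j ω) (y ω)} |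
            MeasurableSpace.comap (Z j) inferInstance⟧) ∧
    -- symmetry given `z_j`, on the event that the lasso selects all true signals
    (∀ j, β j = 0 → ∀ ν : Measure Ω,
      ν = μ[|{ω | activeSet β ⊆ lassoSet X lam (y ω)}] →
      ∀ t : ℝ, 0 < t →
        ν⟦{ω | lassoMirrorStat X lam σ j (Z j ω) (y ω) ≤ -t} |
          MeasurableSpace.comap (Z j) inferInstance⟧ =ᵐ[ν]
        ν⟦{ω | t ≤ lassoMirrorStat X lam σ j (Z j ω) (y ω)} |
          MeasurableSpace.comap (Z j) inferInstance⟧) ∧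
    -- this event has probability at least `1 - 2 / p`
    (∀ φ₀ : ℝ, 0 < φ₀ → CompatibilityCondition X β φ₀ → SignalStrength n β σ φ₀ →
      lam = 2 * n * (4 * σ * Real.sqrt (Real.log p / n)) →
      1 - 2 / (p : ℝ) ≤ μ.real {ω | activeSet β ⊆ lassoSet X lam (y ω)}) := by
  obtain rfl : y = fun ω => X *ᵥ β + ε ω := funext hy
  have hym : Measurable fun ω => X *ᵥ β + ε ω := measurable_const.add hε
  have hM : ∀ j, AEMeasurable (fun ω => lassoMirrorStat X lam σ j (Z j ω) (X *ᵥ β + ε ω)) μ :=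
    fun j => aemeasurable_lassoMirrorStat hX hlam hym huniq (hZ j) (hZlaw j) σ j
  have hle : ∀ j t, NullMeasurableSet
      {ω | lassoMirrorStat X lam σ j (Z j ω) (X *ᵥ β + ε ω) ≤ t} μ := fun j t =>
    nullMeasurableSet_le (hM j) aemeasurable_const
  have hge : ∀ j t, NullMeasurableSet
      {ω | t ≤ lassoMirrorStat X lam σ j (Z j ω) (X *ᵥ β + ε ω)} μ := fun j t =>
    nullMeasurableSet_le aemeasurable_const (hM j)
  have hnull := nullMeasurableSet_outcome hlam hym huniq
  refine ⟨hM, ?_, ?_, ?_⟩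
  · rintro j hj S - hS s ν rfl t ht
    exact condProb_cond_congr (hZ j) (hle j _) (hge j _) (hnull S s) fun C hC =>
      measure_outcome_symm hX hσ hlam hε hεlaw (hZ j) (hZlaw j) (hindep j) huniq hj hS s hC ht
  · rintro j hj ν rfl t ht
    rw [screening_eq_biUnion X lam (fun ω => X *ᵥ β + ε ω)]
    refine condProb_cond_congr (hZ j) (hle j _) (hge j _)
      (Finset.nullMeasurableSet_biUnion _ fun o _ => hnull _ _) fun C hC => ?_
    have hdisj : ∀ D : Set Ω, ((Finset.univ.filter
        fun o : Σ S : Finset (Fin p), ({k // k ∈ S} → Bool) => activeSet β ⊆ o.1 :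
          Finset _) : Set _).Pairwise (Function.onFun (AEDisjoint μ)
          fun o : Σ S : Finset (Fin p), ({k // k ∈ S} → Bool) =>
            D ∩ outcome X lam (fun ω => X *ᵥ β + ε ω) o.1 (boolSign o.2)) :=
      fun D o _ o' _ hne => ((pairwise_disjoint_outcome X lam _ hne).mono
        Set.inter_subset_right Set.inter_subset_right).aedisjoint
    have hpre : NullMeasurableSet (Z j ⁻¹' C) μ := (hZ j hC).nullMeasurableSet
    rw [Set.inter_iUnion₂, Set.inter_iUnion₂,
      measure_biUnion_finset₀ (hdisj _) fun o _ => ((hle j _).inter hpre).inter (hnull _ _),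
      measure_biUnion_finset₀ (hdisj _) fun o _ => ((hge j _).inter hpre).inter (hnull _ _)]
    refine Finset.sum_congr rfl fun o ho => ?_
    exact measure_outcome_symm hX hσ hlam hε hεlaw (hZ j) (hZlaw j) (hindep j) huniq hj
      (Finset.mem_filter.1 ho).2 _ hC ht
  · intro φ₀ hφ hcomp hsig hlam'
    exact le_measureReal_activeSet_subset_lassoSet μ hX hσ hlam hε hεlaw huniq hφ hcomp hsig hlam'
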